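/- Let $q=2^r$, let $F=\mathbb F_q(x)$ be the rational function field, and let $E'=E_1E_2$ be the compositum of $E_1=F(y_1)$ and $E_2=F(y_2)$, where $y_1^2+y_1=x$ and $y_2^2+y_2=1/x$. Then $E'/F$ is a Galois extension of degree $4$. Let $H=\{\sigma\in \mathrm{Gal}(E'/F) : \sigma(y_1)-y_1=\sigma(y_2)-y_2\}$ be the diagonal subgroup of $\mathrm{Gal}(E'/F)\cong \mathbb Z/2\mathbb Z\times\mathbb Z/2\mathbb Z$, and let $E$ be its fixed field; then $E=F(y)$ with $y=y_1+y_2$, so that $y^2+y=x+1/x$. A monic irreducible polynomial $f=T^n+a_{n-1}T^{n-1}+\dots+a_1T+a_0\in\mathbb F_q[T]$ of degree $n\ge 1$ with $a_0\neq 0$ is called an $A$-polynomial if $\mathrm{Tr}_{\mathbb F_q/\mathbb F_2}(a_{n-1})=1$ and $\mathrm{Tr}_{\mathbb F_q/\mathbb F_2}(a_1/a_0)=1$ (the polynomial $f=T$ is not an $A$-polynomial). For $n\geq 1$ let $A_r(n)$ be the number of $A$-polynomials of degree $n$ in $\mathbb F_q[T]$, and let $C_r(n)$ be the number of places of $E$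 of degree $n$ (over $\mathbb F_q$) that are inert in the quadratic extension $E'/E$. Then: (i) For every monic irreducible polynomial $f\in\mathbb F_q[T]$, with associated place $P_f$ of $F$, and for every place $P'$ of $E'$ above $P_f$, the polynomial $f$ is an $A$-polynomial if and only if the decomposition group $G(P'|P_f)$ of $P'$ in $E'/F$ equals $H$. (ii) For every $n\ge 1$, the number $C_r(n)$ is finite and $C_r(n)=2A_r(n)$. -/

import Mathlib

open Polynomial IntermediateField

/-- `f` is an `A`-polynomial over the finite field `k` of characteristic `2`: it is monic and
irreducible, `f = T ^ n + a_{n-1} T ^ (n-1) + ... + a_1 T + a_0`, with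
`Tr (a_{n-1}) = 1` and `Tr (a_1 / a_0) = 1`, where `Tr` is the trace from `k` to `𝔽₂`. -/
def IsAPolynomial {k : Type*} [Field k] [Algebra (ZMod 2) k] (f : k[X]) : Prop :=
  f.Monic ∧ Irreducible f ∧
    Algebra.trace (ZMod 2) k (f.coeff (f.natDegree - 1)) = 1 ∧
    f.coeff 0 ≠ 0 ∧ Algebra.trace (ZMod 2) k (f.coeff 1 / f.coeff 0) = 1

/-- The number of `A`-polynomials of degree `n` over `k`. -/
noncomputable def numAPolynomials (k : Type*) [Field k] [Algebra (ZMod 2) k] (n : ℕ) : ℕ :=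
  Set.ncard {f : k[X] | IsAPolynomial f ∧ f.natDegree = n}

/-- A place of a function field `K` over `k`, given by its valuation ring:
a valuation ring of `K` that contains `k` and is different from `K`. -/
@[ext]
structure Place (k K : Type*) [Field k] [Field K] [Algebra k K] where
  /-- The valuation ring of the place. -/
  ring : ValuationSubring K
  algebraMap_mem : ∀ c : k, algebraMap k K c ∈ ring
  ne_top : ring ≠ ⊤

namespace Place

section Degree

variable {k K : Type*} [Field k] [Field K] [Algebra k K]

/-- The inclusion of the constants into the valuation ring of a place. -/
def constMap (P : Place k K) : k →+* P.ring :=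
  (algebraMap k K).codRestrict P.ring.toSubring P.algebraMap_mem

/-- The degree of a place: the dimension over `k` of its residue field. -/
noncomputable def degree (P : Place k K) : ℕ :=
  letI : Algebra k (IsLocalRing.ResidueField P.ring) :=
    ((IsLocalRing.residue P.ring).comp P.constMap).toAlgebra
  Module.finrank k (IsLocalRing.ResidueField P.ring)

end Degree

section Extension

variable {k K L : Type*} [Field k] [Field K] [Field L] [Algebra k K] [Algebra k L] [Algebra K L]

/-- The place `P'` of `L` lies above the place `P` of `K`: the valuation ring of `P` is the
intersection with `K` of the valuation ring of `P'`. -/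
def LiesAbove (P' : Place k L) (P : Place k K) : Prop :=
  P'.ring.comap (algebraMap K L) = P.ring

/-- The inclusion of the valuation rings of two places, one above the other. -/
def LiesAbove.ringMap {P' : Place k L} {P : Place k K} (h : P'.LiesAbove P) :
    P.ring →+* P'.ring :=
  ((algebraMap K L).comp P.ring.subtype).codRestrict P'.ring.toSubring fun a =>
    ValuationSubring.mem_comap.1 ((SetLike.ext_iff.1 h (a : K)).2 a.2)

theorem LiesAbove.isLocalHom_ringMap {P' : Place k L} {P : Place k K} (h : P'.LiesAbove P) :
    IsLocalHom h.ringMap where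
  map_nonunit a ha := by
    obtain ⟨b, hb⟩ := ha.exists_right_inv
    have hb' : algebraMap K L (a : K) * (b : L) = 1 := congrArg Subtype.val hb
    have hinv : algebraMap K L ((a : K)⁻¹) = (b : L) := by
      rw [map_inv₀]
      exact inv_eq_of_mul_eq_one_right hb'
    have ha0 : (a : K) ≠ 0 := by
      intro h0
      rw [h0, map_zero, zero_mul] at hb'
      exact zero_ne_one hb'
    have hmem : (a : K)⁻¹ ∈ P.ring := by
      refine (SetLike.ext_iff.1 h _).1 (ValuationSubring.mem_comap.2 ?_)
      rw [hinv]
      exact b.2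
    exact IsUnit.of_mul_eq_one ⟨(a : K)⁻¹, hmem⟩ (Subtype.ext (mul_inv_cancel₀ ha0))

/-- The relative degree `f(P' | P)`: the degree of the extension of residue fields. -/
noncomputable def LiesAbove.relDegree {P' : Place k L} {P : Place k K} (h : P'.LiesAbove P) : ℕ :=
  haveI := h.isLocalHom_ringMap
  letI : Algebra (IsLocalRing.ResidueField P.ring) (IsLocalRing.ResidueField P'.ring) :=
    (IsLocalRing.ResidueField.map h.ringMap).toAlgebra
  Module.finrank (IsLocalRing.ResidueField P.ring) (IsLocalRing.ResidueField P'.ring)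

variable (L) in
/-- The place `P` of `K` is inert in the finite extension `L / K`: there is exactly one place of
`L` above `P`, and its relative degree is `[L : K]`. -/
def IsInert (P : Place k K) : Prop :=
  ∃ (P' : Place k L) (h : P'.LiesAbove P),
    (∀ P'' : Place k L, P''.LiesAbove P → P'' = P') ∧ h.relDegree = Module.finrank K L

end Extension

section Rational

variable {k : Type*} [Field k]

/-- The prime ideal of `k[X]` generated by an irreducible polynomial. -/
noncomputable def primeOfIrreducible (f : k[X]) (hf : Irreducible f) :
    IsDedekindDomain.HeightOneSpectrum k[X] where
  asIdeal := Ideal.span {f}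
  isPrime := (Ideal.span_singleton_prime hf.ne_zero).2 hf.prime
  ne_bot := by
    rw [Ne, Ideal.span_singleton_eq_bot]
    exact hf.ne_zero

/-- The place `P_f` of the rational function field `k(x)` attached to an irreducible polynomial
`f`; its valuation ring is the one of the `f`-adic valuation. -/
noncomputable def ofIrreducible (f : k[X]) (hf : Irreducible f) : Place k (RatFunc k) where
  ring := ((primeOfIrreducible f hf).valuation (RatFunc k)).valuationSubring
  algebraMap_mem c := by
    rw [Valuation.mem_valuationSubring_iff, IsScalarTower.algebraMap_apply k k[X] (RatFunc k)]
    exact (primeOfIrreducible f hf).valuation_le_one _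
  ne_top h := by
    have hlt : (primeOfIrreducible f hf).valuation (RatFunc k) (algebraMap k[X] (RatFunc k) f) < 1 :=
      ((primeOfIrreducible f hf).valuation_lt_one_iff_mem f).2 (Ideal.mem_span_singleton_self f)
    have hne : algebraMap k[X] (RatFunc k) f ≠ 0 := by
      simpa using hf.ne_zero
    have hmem : (algebraMap k[X] (RatFunc k) f)⁻¹ ∈
        ((primeOfIrreducible f hf).valuation (RatFunc k)).valuationSubring := by
      rw [h]
      trivial
    rw [Valuation.mem_valuationSubring_iff, map_inv₀] at hmem
    have h0 : 0 < (primeOfIrreducible f hf).valuation (RatFunc k)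
        (algebraMap k[X] (RatFunc k) f) := by
      rw [zero_lt_iff, Ne, map_eq_zero]
      exact hne
    exact absurd hlt (not_lt.2 ((inv_le_one₀ h0).1 hmem))

end Rational

end Place

/-- The diagonal subgroup of `Gal(L / F)` with respect to elements `y₁, y₂` of `L`: the
automorphisms that translate `y₁` and `y₂` by the same element. For Artin-Schreier generators
`y₁, y₂` of a biquadratic extension in characteristic `2`, the Galois group is identified with
`ℤ/2 × ℤ/2` through `σ ↦ (σ y₁ - y₁, σ y₂ - y₂)`. -/
def diagonalSubgroup (F : Type*) {L : Type*} [Field F] [Field L] [Algebra F L] (y₁ y₂ : L) :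
    Subgroup (L ≃ₐ[F] L) where
  carrier := {σ | σ y₁ - y₁ = σ y₂ - y₂}
  one_mem' := by simp
  mul_mem' {σ τ} hσ hτ := by
    simp only [Set.mem_ofPred_eq, AlgEquiv.mul_apply] at *
    have h := congrArg σ hτ
    simp only [map_sub] at h
    linear_combination h + hσ
  inv_mem' {σ} hσ := by
    simp only [Set.mem_ofPred_eq] at *
    apply σ.injective
    have h1 : ∀ z, σ (σ⁻¹ z) = z := fun z => σ.apply_symm_apply z
    simp only [map_sub, h1]
    linear_combination -hσ

/-- The number of places of degree `n` of `K` that are inert in the extension `L / K`. -/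
noncomputable def numInertPlaces (k K L : Type*) [Field k] [Field K] [Field L] [Algebra k K]
    [Algebra k L] [Algebra K L] (n : ℕ) : ℕ :=
  Set.ncard {P : Place k K | P.degree = n ∧ P.IsInert L}

/-! Everything is decided by the solvability of `g ^ 2 + g = c` in the residue field `k[T]/(f)` for
`c = x`, `1/x` and `x + 1/x`. In `k[T]/(f)` the elements `x` and `1/x` have traces `a_{n-1}` and
`a_1/a_0` up to sign, so by additive Hilbert 90 and transitivity of the trace, `f` is an
`A`-polynomial exactly when the first two equations have no solution (`isAPolynomial_iff`). The
third one is then solvable, because `1 + 1 = 0` in `𝔽₂` (`IsAPolynomial.artinSchreierSolvable_add`).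

Above an `A`-polynomial the residue of `y = y₁ + y₂` therefore already lies in `k[T]/(f)`. So the
places of `E` over `P_f` have degree `n`, and there are two of them, one for each root `g`, `g + 1`
(`Place.exists_liesAbove_eq_pair`). At each of them the equation of `y₁` stays irreducible over the
residue field, so the place is inert (`Place.degree_and_isInert_of_isAPolynomial`).

Conversely, let `τ` be the nontrivial element of `H`. If `τ` stabilizes a place of `E'`, it acts on
the residue field and shifts the residues of integral `y₁` and `y₂` by `1`. These residues then do
not come from `k[T]/(f)`, which forces `f` to be an `A`-polynomial
(`Place.isAPolynomial_of_translation`). The same shift excludes `f = T` and the infinite place,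
where `y₁` or `y₂` would have residue `0` or `1`. Inertness supplies the stability: `τ` fixes `E`,
and only one place lies above an inert one. Applied to `y`, the argument also keeps elements outside
`H` from stabilizing a place over an `A`-polynomial. -/

/-- Additive Hilbert 90 for a finite field of characteristic two. -/
theorem FiniteField.exists_sq_add_self_eq_iff {K : Type*} [Field K] [Finite K]
    [Algebra (ZMod 2) K] (c : K) :
    (∃ b : K, b ^ 2 + b = c) ↔ Algebra.trace (ZMod 2) K c = 0 := by
  have : Module.Finite (ZMod 2) K := Module.Finite.of_finite
  have : CharP K 2 := charP_of_injective_algebraMap (algebraMap (ZMod 2) K).injective 2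
  let fr : K ≃ₐ[ZMod 2] K := FiniteField.frobeniusAlgEquivOfAlgebraic (ZMod 2) K
  have hfr : ∀ b, fr b = b ^ 2 := fun b => by
    simp [fr]
  let φ : K →ₗ[ZMod 2] K := fr.toLinearMap + LinearMap.id
  have hφ : ∀ b, φ b = b ^ 2 + b := fun b => by simp [φ, hfr]
  have hle : LinearMap.range φ ≤ LinearMap.ker (Algebra.trace (ZMod 2) K) := by
    rintro _ ⟨b, rfl⟩
    rw [LinearMap.mem_ker, hφ, map_add, ← hfr, Algebra.trace_eq_of_algEquiv]
    exact CharTwo.add_self_eq_zero _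
  have hker : Module.finrank (ZMod 2) (LinearMap.ker φ) ≤ 1 := by
    have : LinearMap.ker φ ≤ Submodule.span (ZMod 2) {(1 : K)} := by
      intro b hb
      rw [LinearMap.mem_ker, hφ] at hb
      have hb' : b * (b + 1) = 0 := by linear_combination hb
      rcases mul_eq_zero.1 hb' with h | h
      · rw [h]; exact Submodule.zero_mem _
      · rw [CharTwo.add_eq_zero.1 h]; exact Submodule.mem_span_singleton_self _
    exact (Submodule.finrank_mono this).trans (finrank_span_singleton one_ne_zero).le
  have hsurj : LinearMap.range (Algebra.trace (ZMod 2) K) = ⊤ :=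
    LinearMap.range_eq_top.2 (Algebra.trace_surjective (ZMod 2) K)
  have h1 := LinearMap.finrank_range_add_finrank_ker φ
  have h2 := LinearMap.finrank_range_add_finrank_ker (Algebra.trace (ZMod 2) K)
  rw [hsurj, finrank_top, Module.finrank_self] at h2
  -- The kernel of `b ^ 2 + b` is at most `{0, 1}`, so its image has codimension at most one, which
  -- is the codimension of the kernel of the nonzero trace.
  have heq := Submodule.eq_of_le_of_finrank_le hle (by omega)
  rw [← LinearMap.mem_ker, ← heq]
  simp only [LinearMap.mem_range, hφ]

/-! ### Traces of `x` and `1/x` modulo `f`, and Artin-Schreier equations modulo `f`. -/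

section

variable {k : Type*} [Field k]

theorem AdjoinRoot.trace_root {f : k[X]} (hf : f.Monic) [Fact (Irreducible f)] :
    Algebra.trace k (AdjoinRoot f) (AdjoinRoot.root f) = -f.coeff (f.natDegree - 1) := by
  have h := PowerBasis.trace_gen_eq_nextCoeff_minpoly (AdjoinRoot.powerBasis hf.ne_zero)
  rw [AdjoinRoot.minpoly_powerBasis_gen_of_monic hf, AdjoinRoot.powerBasis_gen,
    nextCoeff_of_natDegree_pos (Fact.out : Irreducible f).natDegree_pos] at h
  exact h

/-- Reversing the coefficients of `f` and dividing by its constant term gives the minimal polynomial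
of `α⁻¹`, whose next-to-leading coefficient can be read off. -/
theorem Algebra.trace_inv_of_root {L : Type*} [Field L] [Algebra k L] [FiniteDimensional k L]
    {f : k[X]} (hn : f.natDegree = Module.finrank k L) (h0 : f.coeff 0 ≠ 0)
    {α : L} (hα : aeval α f = 0) (htop : k⟮α⟯ = ⊤) :
    Algebra.trace k L α⁻¹ = -(f.coeff 1 / f.coeff 0) := by
  have hα0 : α ≠ 0 := by
    rintro rfl
    rw [aeval_def, eval₂_at_zero] at hα
    exact h0 ((map_eq_zero _).1 hα)
  have htop' : k⟮α⁻¹⟯ = ⊤ := by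
    rw [_root_.eq_top_iff, ← htop, adjoin_simple_le_iff]
    simpa using inv_mem (mem_adjoin_simple_self k α⁻¹)
  have htr : f.natTrailingDegree = 0 := natTrailingDegree_eq_zero.2 (Or.inr h0)
  have hdeg : f.reverse.natDegree = f.natDegree := by rw [reverse_natDegree, htr, Nat.sub_zero]
  have hpos : 0 < f.natDegree := hn ▸ Module.finrank_pos
  have hlead : f.reverse.leadingCoeff = f.coeff 0 := by
    rw [reverse_leadingCoeff, trailingCoeff, htr]
  have hmin : f.reverse * C (f.coeff 0)⁻¹ = minpoly k α⁻¹ := by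
    refine eq_of_monic_of_dvd_of_natDegree_le (minpoly.monic (.of_finite k _)) ?_ ?_ ?_
    · rw [Monic, leadingCoeff_mul, hlead, leadingCoeff_C, mul_inv_cancel₀ h0]
    · refine minpoly.dvd _ _ ?_
      let := invertibleOfNonzero hα0
      have := (eval₂_reverse_eq_zero_iff (algebraMap k L) α f).2 hα
      rw [map_mul, aeval_def, ← invOf_eq_inv, this, zero_mul]
    · rw [natDegree_mul_C (inv_ne_zero h0), hdeg, ← adjoin.finrank (.of_finite k _), htop',
        finrank_top', hn]
  have hone : f.reverse.coeff (f.natDegree - 1) = f.coeff 1 := by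
    rw [coeff_reverse, revAt_le (by omega)]
    congr 1
    omega
  rw [trace_eq_finrank_mul_minpoly_nextCoeff, htop', IntermediateField.finrank_top, Nat.cast_one,
    one_mul, ← hmin, nextCoeff_of_natDegree_pos (by rwa [natDegree_mul_C (inv_ne_zero h0), hdeg]),
    natDegree_mul_C (inv_ne_zero h0), hdeg, coeff_mul_C, hone, div_eq_mul_inv]

theorem AdjoinRoot.trace_root_inv {f : k[X]} (hf : f.Monic) [Fact (Irreducible f)]
    (h0 : f.coeff 0 ≠ 0) :
    Algebra.trace k (AdjoinRoot f) (AdjoinRoot.root f)⁻¹ = -(f.coeff 1 / f.coeff 0) := by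
  have := hf.finite_adjoinRoot
  refine Algebra.trace_inv_of_root ?_ h0 (AdjoinRoot.eval₂_root f) (adjoin_root_eq_top f)
  rw [(AdjoinRoot.powerBasis hf.ne_zero).finrank, AdjoinRoot.powerBasis_dim]

/-- Solvability of `g ^ 2 + g = c` modulo `f`. -/
def ArtinSchreierSolvable (f c : k[X]) : Prop := ∃ g : k[X], f ∣ g ^ 2 + g + c

/-- In characteristic two such an `h` is a polynomial representative of `1/x` modulo `f`, so that
`1/x` can be handled as a polynomial. The witness comes from solving `f = f.divX * X + f.coeff 0`
for the constant. -/
theorem exists_dvd_mul_X_add_one {f : k[X]} (h0 : f.coeff 0 ≠ 0) : ∃ h, f ∣ h * X + 1 := by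
  refine ⟨C (f.coeff 0)⁻¹ * f.divX, C (f.coeff 0)⁻¹, ?_⟩
  have h1 : (C (f.coeff 0) : k[X]) * C (f.coeff 0)⁻¹ = 1 := by
    rw [← C_mul, mul_inv_cancel₀ h0, C_1]
  linear_combination C (f.coeff 0)⁻¹ * f.divX_mul_X_add - h1

variable [Algebra (ZMod 2) k]

theorem AdjoinRoot.mk_eq_root_inv {f h : k[X]} [Fact (Irreducible f)] (hh : f ∣ h * X + 1) :
    AdjoinRoot.mk f h = (AdjoinRoot.root f)⁻¹ := by
  have : CharP (AdjoinRoot f) 2 :=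
    charP_of_injective_algebraMap (algebraMap (ZMod 2) (AdjoinRoot f)).injective 2
  have := AdjoinRoot.mk_eq_zero.2 hh
  rw [map_add, map_mul, map_one, AdjoinRoot.mk_X] at this
  exact eq_inv_of_mul_eq_one_left (CharTwo.add_eq_zero.1 this)

variable [Finite k]

/-- This is additive Hilbert 90 in the finite field `AdjoinRoot f`, with its absolute trace factored
through `k`. -/
theorem artinSchreierSolvable_iff {f : k[X]} (hf : f.Monic) [Fact (Irreducible f)] (c : k[X]) :
    ArtinSchreierSolvable f c ↔
      Algebra.trace (ZMod 2) k (Algebra.trace k (AdjoinRoot f) (AdjoinRoot.mk f c)) = 0 := by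
  have := hf.finite_adjoinRoot
  have : Finite (AdjoinRoot f) := Module.finite_of_finite k
  have : CharP (AdjoinRoot f) 2 :=
    charP_of_injective_algebraMap (algebraMap (ZMod 2) (AdjoinRoot f)).injective 2
  have : Module.Finite (ZMod 2) k := Module.Finite.of_finite
  rw [Algebra.trace_trace, ← FiniteField.exists_sq_add_self_eq_iff]
  constructor
  · rintro ⟨g, hg⟩
    refine ⟨AdjoinRoot.mk f g, ?_⟩
    have := AdjoinRoot.mk_eq_zero.2 hg
    rw [map_add] at this
    simpa using CharTwo.add_eq_zero.1 this
  · rintro ⟨b, hb⟩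
    obtain ⟨g, rfl⟩ := AdjoinRoot.mk_surjective b
    refine ⟨g, AdjoinRoot.mk_eq_zero.1 ?_⟩
    rw [map_add, map_add, map_pow, hb, CharTwo.add_self_eq_zero]

theorem ZMod.ne_zero_iff_eq_one_of_two (a : ZMod 2) : a ≠ 0 ↔ a = 1 := by
  revert a; decide

theorem isAPolynomial_iff {f h : k[X]} (hf : f.Monic) (hi : Irreducible f) (h0 : f.coeff 0 ≠ 0)
    (hh : f ∣ h * X + 1) :
    IsAPolynomial f ↔ ¬ ArtinSchreierSolvable f X ∧ ¬ ArtinSchreierSolvable f h := by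
  have := Fact.mk hi
  rw [artinSchreierSolvable_iff hf, artinSchreierSolvable_iff hf, AdjoinRoot.mk_X,
    AdjoinRoot.mk_eq_root_inv hh, AdjoinRoot.trace_root hf, AdjoinRoot.trace_root_inv hf h0,
    map_neg, map_neg, neg_eq_zero, neg_eq_zero, ← Ne, ← Ne, ZMod.ne_zero_iff_eq_one_of_two,
    ZMod.ne_zero_iff_eq_one_of_two]
  simp [IsAPolynomial, hf, hi, h0]

theorem IsAPolynomial.artinSchreierSolvable_add {f h : k[X]} (hA : IsAPolynomial f)
    (hh : f ∣ h * X + 1) : ArtinSchreierSolvable f (X + h) := by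
  obtain ⟨hf, hi, h1, h0, h2⟩ := hA
  have := Fact.mk hi
  rw [artinSchreierSolvable_iff hf, map_add, AdjoinRoot.mk_X, AdjoinRoot.mk_eq_root_inv hh,
    map_add, AdjoinRoot.trace_root hf, AdjoinRoot.trace_root_inv hf h0, map_add, map_neg, map_neg,
    h1, h2]
  decide

end

/-! ### Valuation rings and their extensions. -/

namespace ValuationSubring

variable {K L : Type*} [Field K] [Field L]

theorem valuation_lt_one_iff_of_comap {A : ValuationSubring L} {B : ValuationSubring K}
    {i : K →+* L} (h : A.comap i = B) (z : K) : A.valuation (i z) < 1 ↔ B.valuation z < 1 := by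
  rw [← mem_nonunits_iff, ← mem_nonunits_iff, mem_nonunits_iff_or, mem_nonunits_iff_or,
    map_eq_zero, ← map_inv₀, ← h, mem_comap]

theorem mem_of_sq_add_self_mem {A : ValuationSubring L} {y : L} (h : y ^ 2 + y ∈ A) : y ∈ A := by
  rcases A.mem_or_inv_mem y with hy | hy
  · exact hy
  by_cases h0 : y = 0
  · rw [h0]; exact A.zero_mem
  have : y = (y ^ 2 + y) * y⁻¹ - 1 := by field_simp; ring
  rw [this]
  exact sub_mem (MulMemClass.mul_mem h hy) A.one_mem

theorem valuation_lt_one_of_mul {A : ValuationSubring L} {a b : L}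
    (h : A.valuation (a * b) < 1) : A.valuation a < 1 ∨ A.valuation b < 1 := by
  by_contra! hab
  rw [map_mul] at h
  exact absurd h (not_lt.2 (one_le_mul hab.1 hab.2))

theorem valuation_mul_lt_one {A : ValuationSubring L} {a b : L}
    (ha : A.valuation a < 1) (hb : b ∈ A) : A.valuation (a * b) < 1 := by
  rw [map_mul]
  exact mul_lt_one_of_lt_of_le ha ((A.valuation_le_one_iff b).2 hb)

theorem mem_of_valuation_lt_one {A : ValuationSubring L} {a : L}
    (ha : A.valuation a < 1) : a ∈ A :=
  (A.valuation_le_one_iff a).1 ha.le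

theorem inv_mem_of_not_lt_one {A : ValuationSubring L} {a : L}
    (ha : ¬ A.valuation a < 1) : a⁻¹ ∈ A := by
  rw [← mem_nonunits_iff, mem_nonunits_iff_or, not_or, not_not] at ha
  exact ha.2

/-- Chevalley's theorem provides a valuation ring dominating the image of `B`. It cuts out nothing
larger than `B`: if `z ∉ B`, then `z⁻¹` is in the maximal ideal, hence a nonunit of `A`. -/
theorem exists_comap_eq (i : K →+* L) (B : ValuationSubring K) :
    ∃ A : ValuationSubring L, A.comap i = B := by
  let S : Subring L := B.toSubring.map i
  let e : B →+* S := (i.comp B.subtype).codRestrict S fun b => ⟨b, b.2, rfl⟩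
  have he : Function.Surjective e := by
    rintro ⟨_, b, hb, rfl⟩
    exact ⟨⟨b, hb⟩, rfl⟩
  let I : Ideal S := (IsLocalRing.maximalIdeal B).map e
  have hI : I ≠ ⊤ := by
    rw [Ne, Ideal.eq_top_iff_one, Ideal.mem_map_iff_of_surjective e he]
    rintro ⟨b, hb, h⟩
    have h1 : i (b : K) = i 1 := by rw [map_one]; exact congrArg Subtype.val h
    have h2 : b = 1 := Subtype.ext (i.injective h1)
    exact (IsLocalRing.maximalIdeal.isMaximal B).ne_top ((Ideal.eq_top_iff_one _).2 (h2 ▸ hb))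
  obtain ⟨A, hA, hIA⟩ := Ideal.image_subset_nonunits_valuationSubring I hI
  refine ⟨A, SetLike.ext fun z => ⟨fun hz => ?_, fun hz => hA ⟨z, hz, rfl⟩⟩⟩
  by_contra hzB
  have hz0 : z ≠ 0 := by rintro rfl; exact hzB B.zero_mem
  have hinv : z⁻¹ ∈ B.nonunits := (inv_mem_nonunits_iff B).2 (Or.inr hzB)
  obtain ⟨hm, hmm⟩ := mem_nonunits_iff_exists_mem_maximalIdeal.1 hinv
  have h1 : i z⁻¹ ∈ A.nonunits :=
    hIA ⟨e ⟨z⁻¹, hm⟩, Ideal.mem_map_of_mem e hmm, rfl⟩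
  rw [map_inv₀, inv_mem_nonunits_iff, map_eq_zero] at h1
  exact h1.elim hz0 fun h => h hz

section Quadratic

variable {A : ValuationSubring L} {B : ValuationSubring K} {i : K →+* L}

/-- If `y ^ 2 + y = c` is irreducible over the residue field of `B`, then the residues of `1, y` in
every extension of `B` are linearly independent. -/
theorem valuation_add_mul_lt_one [CharP K 2] (h : A.comap i = B) {y : L} {c : K} (hc : c ∈ B)
    (hy : y ^ 2 + y = i c) (hno : ∀ z ∈ B, ¬ B.valuation (z ^ 2 + z + c) < 1) {u v : K}
    (hu : u ∈ B) (hv : v ∈ B) (huv : A.valuation (i u + i v * y) < 1) :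
    B.valuation u < 1 ∧ B.valuation v < 1 := by
  have : CharP L 2 := charP_of_injective_ringHom i.injective 2
  have hyA : y ∈ A := mem_of_sq_add_self_mem (by rw [hy]; rw [← h] at hc; exact hc)
  have hvm : B.valuation v < 1 := by
    by_contra hv1
    have hvi := inv_mem_of_not_lt_one hv1
    have hv0 : v ≠ 0 := by rintro rfl; simp at hv1
    have hz : u * v⁻¹ ∈ B := MulMemClass.mul_mem hu hvi
    refine hno _ hz ?_
    rw [← valuation_lt_one_iff_of_comap h]
    -- With `z = u / v`, the left side is the norm `(z + y) (z + y + 1)`, which has the small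
    -- element `u + v y` as a factor.
    have e : i ((u * v⁻¹) ^ 2 + u * v⁻¹ + c) =
        (i u + i v * y) * (i v⁻¹ * (i (u * v⁻¹) + y + 1)) := by
      have hvv : i v * i v⁻¹ = 1 := by rw [← map_mul, mul_inv_cancel₀ hv0, map_one]
      have h2 : (2 : L) = 0 := CharTwo.two_eq_zero
      simp only [map_add, map_pow, map_mul, ← hy]
      linear_combination (- y * (i u * i v⁻¹ + y + 1)) * hvv - i u * i v⁻¹ * y * h2
    rw [e]
    refine valuation_mul_lt_one huv (A.mul_mem _ _ ?_ (A.add_mem _ _ (A.add_mem _ _ ?_ hyA) A.one_mem))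
    · rw [← h] at hvi; exact hvi
    · rw [← h] at hz; exact hz
  refine ⟨?_, hvm⟩
  rw [← valuation_lt_one_iff_of_comap h] at hvm ⊢
  have : i u = (i u + i v * y) - i v * y := by ring
  rw [this]
  exact Valuation.map_sub_lt _ huv (valuation_mul_lt_one hvm hyA)

/-- If `y ^ 2 + y = c` is irreducible over the residue field of `B`, then `1, y` is an integral
basis of every extension of `B` to `K + K y`. -/
theorem add_mul_mem_iff [CharP K 2] (h : A.comap i = B) {y : L} {c : K} (hc : c ∈ B)
    (hy : y ^ 2 + y = i c) (hno : ∀ z ∈ B, ¬ B.valuation (z ^ 2 + z + c) < 1) (u v : K) :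
    i u + i v * y ∈ A ↔ u ∈ B ∧ v ∈ B := by
  have hyA : y ∈ A := mem_of_sq_add_self_mem (by rw [hy]; rw [← h] at hc; exact hc)
  have hAB : ∀ z, i z ∈ A ↔ z ∈ B := fun z => by rw [← h, mem_comap]
  refine ⟨fun huv => ?_, fun ⟨hu, hv⟩ =>
    AddMemClass.add_mem ((hAB u).2 hu) (MulMemClass.mul_mem ((hAB v).2 hv) hyA)⟩
  -- Here `t` will be whichever of `u`, `v` has the larger value. Dividing by it leaves an element
  -- with a coefficient `1`, a unit by the residue independence just proved, so `t` is integral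
  -- along with `u + v y`.
  have key : ∀ t : K, t ≠ 0 → t⁻¹ * u ∈ B → t⁻¹ * v ∈ B →
      (t⁻¹ * u = 1 ∨ t⁻¹ * v = 1) → t ∈ B := by
    intro t ht hu hv h1
    rw [← hAB]
    have hn : ¬ A.valuation (i (t⁻¹ * u) + i (t⁻¹ * v) * y) < 1 := fun hlt => by
      have := valuation_add_mul_lt_one h hc hy hno hu hv hlt
      rcases h1 with h1 | h1 <;> rw [h1] at this <;> simp at this
    have e : i t = (i u + i v * y) * (i (t⁻¹ * u) + i (t⁻¹ * v) * y)⁻¹ := by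
      have e1 : i (t⁻¹ * u) + i (t⁻¹ * v) * y = (i t)⁻¹ * (i u + i v * y) := by
        simp only [map_mul, map_inv₀]; ring
      have h0 : i u + i v * y ≠ 0 := by
        intro h0
        rw [e1, h0, mul_zero, map_zero] at hn
        exact hn zero_lt_one
      have : i t ≠ 0 := by simpa using ht
      rw [e1]; field_simp
    rw [e]
    exact MulMemClass.mul_mem huv (inv_mem_of_not_lt_one hn)
  by_cases hv0 : v = 0
  · subst hv0
    rw [map_zero, zero_mul, add_zero, hAB] at huv
    exact ⟨huv, B.zero_mem⟩
  rcases B.mem_or_inv_mem (v⁻¹ * u) with hq | hq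
  · have hv := key v hv0 hq (by rw [inv_mul_cancel₀ hv0]; exact B.one_mem)
      (Or.inr (inv_mul_cancel₀ hv0))
    refine ⟨?_, hv⟩
    have := MulMemClass.mul_mem hv hq
    rwa [mul_inv_cancel_left₀ hv0] at this
  · by_cases hu0 : u = 0
    · subst hu0
      refine ⟨B.zero_mem, key v hv0 (by rw [mul_zero]; exact B.zero_mem)
        (by rw [inv_mul_cancel₀ hv0]; exact B.one_mem) (Or.inr (inv_mul_cancel₀ hv0))⟩
    rw [mul_inv, inv_inv, mul_comm] at hq
    have hu := key u hu0 (by rw [inv_mul_cancel₀ hu0]; exact B.one_mem) hq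
      (Or.inl (inv_mul_cancel₀ hu0))
    refine ⟨hu, ?_⟩
    have := MulMemClass.mul_mem hu hq
    rwa [mul_inv_cancel_left₀ hu0] at this

end Quadratic

end ValuationSubring

/-! ### Extension and restriction of places, and a criterion for inertness. -/

namespace Place

variable {k K L : Type*} [Field k] [Field K] [Field L] [Algebra k K] [Algebra k L] [Algebra K L]

theorem exists_liesAbove [IsScalarTower k K L] (P : Place k K) :
    ∃ P' : Place k L, P'.LiesAbove P := by
  obtain ⟨A, hA⟩ := ValuationSubring.exists_comap_eq (algebraMap K L) P.ring
  refine ⟨⟨A, fun c => ?_, ?_⟩, hA⟩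
  · rw [IsScalarTower.algebraMap_apply k K L, ← ValuationSubring.mem_comap, hA]
    exact P.algebraMap_mem c
  · rintro rfl
    exact P.ne_top (by rw [← hA]; ext; simp [ValuationSubring.mem_comap])

/-- The restriction of a place to a subfield over which the field is algebraic. -/
def restrict (K : Type*) [Field K] [Algebra k K] [Algebra K L] [IsScalarTower k K L]
    [Algebra.IsAlgebraic K L] (P' : Place k L) : Place k K where
  ring := P'.ring.comap (algebraMap K L)
  algebraMap_mem c := by
    rw [ValuationSubring.mem_comap, ← IsScalarTower.algebraMap_apply]
    exact P'.algebraMap_mem c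
  ne_top h := by
    -- If the restriction were all of `K`, the integrally closed ring `P'.ring` would contain `K`,
    -- hence its algebraic extension `L`.
    refine P'.ne_top (_root_.eq_top_iff.2 fun z _ => ?_)
    have hz : IsIntegral K z := Algebra.IsIntegral.isIntegral z
    have hK : ∀ a : K, algebraMap K L a ∈ P'.ring := fun a => by
      rw [← ValuationSubring.mem_comap, h]; trivial
    let φ : K →+* P'.ring := (algebraMap K L).codRestrict P'.ring.toSubring hK
    let := φ.toAlgebra
    have : IsScalarTower K P'.ring L := .of_algebraMap_eq fun _ => rfl
    obtain ⟨x, rfl⟩ := IsIntegrallyClosed.isIntegral_iff.1 (hz.tower_top (A := P'.ring))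
    exact x.2

theorem liesAbove_restrict [IsScalarTower k K L] [Algebra.IsAlgebraic K L] (P' : Place k L) :
    P'.LiesAbove (P'.restrict K) := rfl

/-- Every extension of `P` has the same integral basis `1, y`, which gives uniqueness, and the
residues of `1, y` form a basis of the residue extension, which gives relative degree two. -/
theorem isInert_of_irreducible [IsScalarTower k K L] [CharP K 2] (P : Place k K) {y : L} {c : K}
    (hspan : ∀ z : L, ∃ u v : K, z = algebraMap K L u + algebraMap K L v * y)
    (hrank : Module.finrank K L = 2) (hc : c ∈ P.ring)
    (hy : y ^ 2 + y = algebraMap K L c)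
    (hno : ∀ z ∈ P.ring, ¬ P.ring.valuation (z ^ 2 + z + c) < 1) : P.IsInert L := by
  obtain ⟨P', hP'⟩ := P.exists_liesAbove (L := L)
  refine ⟨P', hP', fun P'' hP'' => ?_, ?_⟩
  · refine Place.ext (SetLike.ext fun z => ?_)
    obtain ⟨u, v, rfl⟩ := hspan z
    rw [ValuationSubring.add_mul_mem_iff hP'' hc hy hno,
      ValuationSubring.add_mul_mem_iff hP' hc hy hno]
  · have hyA : y ∈ P'.ring := by
      have := (ValuationSubring.add_mul_mem_iff hP' hc hy hno 0 1).2
        ⟨P.ring.zero_mem, P.ring.one_mem⟩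
      simpa using this
    have := hP'.isLocalHom_ringMap
    rw [hrank]
    unfold LiesAbove.relDegree
    let : Algebra (IsLocalRing.ResidueField P.ring) (IsLocalRing.ResidueField P'.ring) :=
      (IsLocalRing.ResidueField.map hP'.ringMap).toAlgebra
    let b : Fin 2 → IsLocalRing.ResidueField P'.ring := ![1, IsLocalRing.residue _ ⟨y, hyA⟩]
    have hmap : ∀ a : P.ring, algebraMap (IsLocalRing.ResidueField P.ring)
        (IsLocalRing.ResidueField P'.ring) (IsLocalRing.residue _ a) =
        IsLocalRing.residue _ (hP'.ringMap a) := fun a => IsLocalRing.ResidueField.map_residue _ _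
    have hli : LinearIndependent (IsLocalRing.ResidueField P.ring) b := by
      rw [LinearIndependent.pair_iff]
      intro s t hst
      obtain ⟨s, rfl⟩ := IsLocalRing.residue_surjective s
      obtain ⟨t, rfl⟩ := IsLocalRing.residue_surjective t
      rw [Algebra.smul_def, Algebra.smul_def, hmap, hmap, mul_one, ← map_mul, ← map_add,
        IsLocalRing.residue_eq_zero_iff, ValuationSubring.valuation_lt_one_iff] at hst
      have := ValuationSubring.valuation_add_mul_lt_one hP' hc hy hno s.2 t.2 hst
      rw [IsLocalRing.residue_eq_zero_iff, IsLocalRing.residue_eq_zero_iff,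
        ValuationSubring.valuation_lt_one_iff, ValuationSubring.valuation_lt_one_iff]
      exact this
    have hsp : ⊤ ≤ Submodule.span (IsLocalRing.ResidueField P.ring) (Set.range b) := by
      rintro z -
      obtain ⟨⟨z, hz⟩, rfl⟩ := IsLocalRing.residue_surjective z
      obtain ⟨u, v, rfl⟩ := hspan z
      obtain ⟨hu, hv⟩ := (ValuationSubring.add_mul_mem_iff hP' hc hy hno u v).1 hz
      have e : (⟨_, hz⟩ : P'.ring) = hP'.ringMap ⟨u, hu⟩ * 1 + hP'.ringMap ⟨v, hv⟩ * ⟨y, hyA⟩ :=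
        Subtype.ext (by simp [LiesAbove.ringMap])
      rw [e, map_add, map_mul, map_mul, ← hmap, ← hmap, ← Algebra.smul_def, ← Algebra.smul_def]
      refine add_mem (Submodule.smul_mem _ _ (Submodule.subset_span ⟨0, by simp [b]⟩))
        (Submodule.smul_mem _ _ (Submodule.subset_span ⟨1, by simp [b]⟩))
    exact (Module.finrank_eq_card_basis (Module.Basis.mk hli hsp)).trans (Fintype.card_fin 2)

end Place

/-! ### Places of the rational function field. -/

namespace Place

section Rational

variable {k : Type*} [Field k]

theorem algebraMap_mem_ofIrreducible {f : k[X]} (hf : Irreducible f) (p : k[X]) :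
    algebraMap k[X] (RatFunc k) p ∈ (ofIrreducible f hf).ring :=
  (primeOfIrreducible f hf).valuation_le_one p

theorem valuation_ofIrreducible_lt_one_iff {f : k[X]} (hf : Irreducible f) (p : k[X]) :
    (ofIrreducible f hf).ring.valuation (algebraMap k[X] (RatFunc k) p) < 1 ↔ f ∣ p := by
  have h := ((primeOfIrreducible f hf).valuation
    (RatFunc k)).isEquiv_valuation_valuationSubring.lt_one_iff_lt_one
    (x := algebraMap k[X] (RatFunc k) p)
  refine h.symm.trans ?_
  rw [(primeOfIrreducible f hf).valuation_lt_one_iff_mem]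
  exact Ideal.mem_span_singleton

/-- A place is determined by its behaviour on polynomials. The ring `B` is left arbitrary so that an
unknown place can be identified with `P_f`. -/
theorem ratFunc_mem_iff {B : ValuationSubring (RatFunc k)} {f : k[X]}
    (hB : ∀ p, algebraMap k[X] (RatFunc k) p ∈ B)
    (hBf : ∀ p, B.valuation (algebraMap k[X] (RatFunc k) p) < 1 ↔ f ∣ p) (z : RatFunc k) :
    z ∈ B ↔ ¬ f ∣ z.denom := by
  have hd : algebraMap k[X] (RatFunc k) z.denom ≠ 0 := by
    simpa using z.denom_ne_zero
  constructor
  · intro hz hfd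
    have hn : algebraMap k[X] (RatFunc k) z.num = algebraMap k[X] (RatFunc k) z.denom * z := by
      nth_rewrite 3 [← z.num_div_denom]
      rw [mul_div_cancel₀ _ hd]
    have h1 := (hBf _).2 hfd
    have h2 := (hBf z.num).1 (hn ▸ ValuationSubring.valuation_mul_lt_one h1 hz)
    obtain ⟨a, b, hab⟩ := z.isCoprime_num_denom
    have h3 : f ∣ 1 := hab ▸ (h2.mul_left a).add (hfd.mul_left b)
    have h4 := (hBf 1).2 h3
    rw [map_one, map_one] at h4
    exact lt_irrefl _ h4
  · intro h
    rw [← z.num_div_denom, div_eq_mul_inv]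
    exact mul_mem (hB _) (ValuationSubring.inv_mem_of_not_lt_one (mt (hBf _).1 h))

theorem mem_ofIrreducible_iff {f : k[X]} (hf : Irreducible f) (z : RatFunc k) :
    z ∈ (ofIrreducible f hf).ring ↔ ¬ f ∣ z.denom :=
  ratFunc_mem_iff (algebraMap_mem_ofIrreducible hf) (valuation_ofIrreducible_lt_one_iff hf) z

theorem exists_polynomial_sub_lt_one {f : k[X]} (hf : Irreducible f) {z : RatFunc k}
    (hz : z ∈ (ofIrreducible f hf).ring) :
    ∃ p : k[X], (ofIrreducible f hf).ring.valuation (z - algebraMap k[X] (RatFunc k) p) < 1 := by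
  have hd : algebraMap k[X] (RatFunc k) z.denom ≠ 0 := by
    simpa using z.denom_ne_zero
  obtain ⟨s, t, hst⟩ := hf.coprime_iff_not_dvd.2 ((mem_ofIrreducible_iff hf z).1 hz)
  -- By the Bézout relation `hst`, `t` inverts the denominator modulo `f`.
  refine ⟨z.num * t, ?_⟩
  have hst' := congrArg (algebraMap k[X] (RatFunc k)) hst
  rw [map_add, map_mul, map_mul, map_one] at hst'
  have hn : algebraMap k[X] (RatFunc k) z.num = algebraMap k[X] (RatFunc k) z.denom * z := by
    nth_rewrite 3 [← z.num_div_denom]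
    rw [mul_div_cancel₀ _ hd]
  have e : z - algebraMap k[X] (RatFunc k) (z.num * t) =
      algebraMap k[X] (RatFunc k) (s * f) * z := by
    rw [map_mul, map_mul, hn]
    linear_combination -z * hst'
  rw [e]
  exact ValuationSubring.valuation_mul_lt_one
    ((valuation_ofIrreducible_lt_one_iff hf _).2 (dvd_mul_left _ _)) hz

theorem exists_pow_mul_mem {f : k[X]} (hf : Irreducible f) (v : RatFunc k) :
    ∃ j : ℕ, algebraMap k[X] (RatFunc k) f ^ j * v ∈ (ofIrreducible f hf).ring := by
  obtain ⟨j, d, hd, hv⟩ := WfDvdMonoid.max_power_factor v.denom_ne_zero hf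
  refine ⟨j, ?_⟩
  have hd0 : algebraMap k[X] (RatFunc k) d ≠ 0 := by
    have : d ≠ 0 := by rintro rfl; exact hd (dvd_zero _)
    simpa using this
  have hf0 : algebraMap k[X] (RatFunc k) f ≠ 0 := by simpa using hf.ne_zero
  have e : algebraMap k[X] (RatFunc k) f ^ j * v =
      algebraMap k[X] (RatFunc k) v.num * (algebraMap k[X] (RatFunc k) d)⁻¹ := by
    nth_rewrite 1 [← v.num_div_denom]
    rw [hv, map_mul, map_pow]
    field_simp
  rw [e]
  exact mul_mem (algebraMap_mem_ofIrreducible hf _) (ValuationSubring.inv_mem_of_not_lt_one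
    (mt (valuation_ofIrreducible_lt_one_iff hf _).1 hd))

theorem exists_eq_mul_of_lt_one {f : k[X]} (hf : Irreducible f) {z : RatFunc k}
    (hz : (ofIrreducible f hf).ring.valuation z < 1) :
    ∃ d ∈ (ofIrreducible f hf).ring, z = algebraMap k[X] (RatFunc k) f * d := by
  have hd : algebraMap k[X] (RatFunc k) z.denom ≠ 0 := by
    simpa using z.denom_ne_zero
  have hn : algebraMap k[X] (RatFunc k) z.num = z * algebraMap k[X] (RatFunc k) z.denom := by
    nth_rewrite 2 [← z.num_div_denom]
    rw [div_mul_cancel₀ _ hd]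
  obtain ⟨e, he⟩ := (valuation_ofIrreducible_lt_one_iff hf z.num).1
    (hn ▸ ValuationSubring.valuation_mul_lt_one hz (algebraMap_mem_ofIrreducible hf _))
  refine ⟨algebraMap k[X] (RatFunc k) e * (algebraMap k[X] (RatFunc k) z.denom)⁻¹,
    mul_mem (algebraMap_mem_ofIrreducible hf _) (ValuationSubring.inv_mem_of_not_lt_one
      (mt (valuation_ofIrreducible_lt_one_iff hf _).1
        ((mem_ofIrreducible_iff hf z).1 (ValuationSubring.mem_of_valuation_lt_one hz)))), ?_⟩
  rw [← mul_assoc, ← map_mul, ← he, ← div_eq_mul_inv, z.num_div_denom]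

theorem ofIrreducible_injective {f g : k[X]} (hf : Irreducible f) (hg : Irreducible g)
    (hfm : f.Monic) (hgm : g.Monic) (h : ofIrreducible f hf = ofIrreducible g hg) : f = g := by
  have h1 : ∀ p, f ∣ p ↔ g ∣ p := fun p => by
    rw [← valuation_ofIrreducible_lt_one_iff hf, ← valuation_ofIrreducible_lt_one_iff hg, h]
  exact eq_of_monic_of_associated hfm hgm
    (associated_of_dvd_dvd ((h1 g).2 dvd_rfl) ((h1 f).1 dvd_rfl))

/-- The maximal ideal meets `k[X]` in a prime ideal. This ideal is nonzero, since otherwise all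
denominators would be units and the ring would be the whole field; its monic generator is `f`. -/
theorem eq_ofIrreducible_of_X_mem (P : Place k (RatFunc k)) (hX : RatFunc.X ∈ P.ring) :
    ∃ (f : k[X]) (_ : f.Monic) (hf : Irreducible f), P = ofIrreducible f hf := by
  classical
  have hB : ∀ p, algebraMap k[X] (RatFunc k) p ∈ P.ring := by
    intro p
    induction p using Polynomial.induction_on' with
    | add p q hp hq => rw [map_add]; exact add_mem hp hq
    | monomial n a =>
      rw [← C_mul_X_pow_eq_monomial, map_mul, map_pow, RatFunc.algebraMap_X,
        RatFunc.algebraMap_C, ← RatFunc.algebraMap_eq_C]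
      exact mul_mem (P.algebraMap_mem a) (pow_mem hX n)
  let φ : k[X] →+* P.ring := (algebraMap k[X] (RatFunc k)).codRestrict P.ring.toSubring hB
  let I : Ideal k[X] := (IsLocalRing.maximalIdeal P.ring).comap φ
  have hI : ∀ p, p ∈ I ↔ P.ring.valuation (algebraMap k[X] (RatFunc k) p) < 1 := fun p =>
    P.ring.valuation_lt_one_iff (φ p)
  have hIp : I.IsPrime := Ideal.IsPrime.comap φ
  have hI0 : I ≠ ⊥ := by
    intro h0
    refine P.ne_top (_root_.eq_top_iff.2 fun z _ => ?_)
    rw [← z.num_div_denom, div_eq_mul_inv]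
    refine mul_mem (hB _) (ValuationSubring.inv_mem_of_not_lt_one fun h => ?_)
    rw [← hI, h0, Ideal.mem_bot] at h
    exact z.denom_ne_zero h
  obtain ⟨g, hg⟩ := IsPrincipalIdealRing.principal I
  rw [Ideal.submodule_span_eq] at hg
  have hg0 : g ≠ 0 := by
    rintro rfl
    exact hI0 (by rw [hg, Ideal.span_singleton_eq_bot])
  have hgi : Irreducible g := ((Ideal.span_singleton_prime hg0).1 (hg ▸ hIp)).irreducible
  have hfi : Irreducible (normalize g) := (normalize_associated g).symm.irreducible hgi
  refine ⟨normalize g, monic_normalize hg0, hfi, Place.ext (SetLike.ext fun z => ?_)⟩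
  rw [mem_ofIrreducible_iff]
  refine ratFunc_mem_iff hB (fun p => ?_) z
  rw [← hI, hg, Ideal.mem_span_singleton, normalize_dvd_iff]

end Rational

/-! ### Places over `P_f` at which the Artin-Schreier generator has a polynomial residue. -/

section OverRational

variable {k K : Type*} [Field k] [Field K] [Algebra (RatFunc k) K]

/-- The embedding of `k[X]` into an extension of the rational function field. -/
noncomputable def polyMap (k K : Type*) [Field k] [Field K] [Algebra (RatFunc k) K] :
    k[X] →+* K :=
  (algebraMap (RatFunc k) K).comp (algebraMap k[X] (RatFunc k))

theorem polyMap_apply (p : k[X]) :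
    polyMap k K p = algebraMap (RatFunc k) K (algebraMap k[X] (RatFunc k) p) := rfl

variable {f : k[X]} {hf : Irreducible f} {A : ValuationSubring K}

theorem polyMap_mem (hA : A.comap (algebraMap (RatFunc k) K) = (ofIrreducible f hf).ring)
    (p : k[X]) : polyMap k K p ∈ A := by
  rw [polyMap_apply, ← ValuationSubring.mem_comap, hA]
  exact algebraMap_mem_ofIrreducible hf p

theorem valuation_polyMap_lt_one_iff
    (hA : A.comap (algebraMap (RatFunc k) K) = (ofIrreducible f hf).ring) (p : k[X]) :
    A.valuation (polyMap k K p) < 1 ↔ f ∣ p := by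
  rw [polyMap_apply, ValuationSubring.valuation_lt_one_iff_of_comap hA,
    valuation_ofIrreducible_lt_one_iff]

/-- If the residue of an Artin-Schreier generator `y` of `K` is that of the polynomial `g`, then
every element of `K` is congruent to a rational function, independently of the place. -/
theorem exists_ratFunc_sub_lt_one [CharP K 2] {y : K} {c : RatFunc k}
    (hy : y ^ 2 + y = algebraMap (RatFunc k) K c)
    (hspan : ∀ z : K, ∃ u v : RatFunc k, z = algebraMap _ K u + algebraMap _ K v * y)
    (f : k[X]) (hf : Irreducible f) (g : k[X]) (z : K) :
    ∃ u : RatFunc k, ∀ A : ValuationSubring K,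
      A.comap (algebraMap (RatFunc k) K) = (ofIrreducible f hf).ring →
      A.valuation (y - polyMap k K g) < 1 → A.valuation (z - algebraMap _ K u) < 1 := by
  obtain ⟨u, v, rfl⟩ := hspan z
  obtain ⟨j, hj⟩ := exists_pow_mul_mem hf v
  have h2 : (2 : K) = 0 := CharTwo.two_eq_zero
  let G := algebraMap k[X] (RatFunc k) g
  let c' := c + G ^ 2 + G
  -- Iterating `a = c' + a ^ 2` gives successive approximations of `a` with error `a ^ 2 ^ m`. They
  -- depend on `c` and `g` only, not on the place.
  let s : ℕ → RatFunc k := fun m => Nat.rec 0 (fun _ t => c' + t ^ 2) m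
  set a := y - polyMap k K g with ha
  have hac : a ^ 2 + a = algebraMap _ K c' := by
    simp only [c', map_add, map_pow, G, ← polyMap_apply, ← hy, ha]
    linear_combination (-y * polyMap k K g - polyMap k K g) * h2
  have hs : ∀ m, a = algebraMap _ K (s m) + a ^ 2 ^ m := by
    intro m
    induction m with
    | zero => simp [s]
    | succ m ih =>
      have e : s (m + 1) = c' + s m ^ 2 := rfl
      have e2 : a ^ 2 = algebraMap _ K (s m) ^ 2 + a ^ 2 ^ (m + 1) := by
        nth_rewrite 1 [ih]
        rw [add_pow_char_of_commute _ (Commute.all _ _), ← pow_mul, ← pow_succ]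
      rw [e, map_add, map_pow, ← hac]
      linear_combination e2 - a ^ 2 * h2
  refine ⟨u + v * G + v * s j, fun A hA hlt => ?_⟩
  have e : algebraMap _ K u + algebraMap _ K v * y - algebraMap _ K (u + v * G + v * s j) =
      algebraMap _ K v * a ^ 2 ^ j := by
    simp only [map_add, map_mul, G, ← polyMap_apply]
    linear_combination algebraMap _ K v * hs j + algebraMap _ K v * ha
  rw [e]
  have haA := ValuationSubring.mem_of_valuation_lt_one hlt
  have hc' : A.valuation (algebraMap _ K c') < 1 := by
    rw [← hac, show a ^ 2 + a = a * (a + 1) by ring]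
    exact ValuationSubring.valuation_mul_lt_one hlt (add_mem haA A.one_mem)
  rw [ValuationSubring.valuation_lt_one_iff_of_comap hA] at hc'
  obtain ⟨d, hd, hcd⟩ := exists_eq_mul_of_lt_one hf hc'
  have hu : ¬ A.valuation (a + 1) < 1 := by
    intro h
    have := Valuation.map_sub_lt _ h hlt
    simp at this
  have h1 : a + 1 ≠ 0 := by intro h; simp [h] at hu
  rw [← hA, ValuationSubring.mem_comap] at hd hj
  -- Since `a (a + 1) = c'` is divisible by `f` and `a + 1` is a unit, `f` divides `a`.
  have haf : a = polyMap k K f * (algebraMap _ K d * (a + 1)⁻¹) := by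
    rw [polyMap_apply, ← mul_assoc, ← map_mul, ← hcd, ← hac]
    field_simp
  have hb := mul_mem hd (ValuationSubring.inv_mem_of_not_lt_one hu)
  set b := algebraMap _ K d * (a + 1)⁻¹
  -- Of the `2 ^ j` factors `a`, `j` cancel the pole of `v` and at least one is left to make the
  -- product small.
  obtain ⟨m, hm⟩ : ∃ m, 2 ^ j = j + 1 + m := Nat.exists_eq_add_of_le j.lt_two_pow_self
  have e3 : algebraMap _ K v * a ^ 2 ^ j = a *
      (algebraMap _ K (algebraMap k[X] (RatFunc k) f ^ j * v) * b ^ j * a ^ m) := by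
    have : a ^ j = polyMap k K f ^ j * b ^ j := by rw [← mul_pow, ← haf]
    rw [hm, pow_add, pow_succ, this, map_mul, map_pow, polyMap_apply]
    ring
  rw [e3]
  exact ValuationSubring.valuation_mul_lt_one hlt
    (mul_mem (mul_mem hj (pow_mem hb j)) (pow_mem haA m))

theorem exists_polyMap_sub_lt_one [CharP K 2] {y : K} {c : RatFunc k}
    (hy : y ^ 2 + y = algebraMap (RatFunc k) K c)
    (hspan : ∀ z : K, ∃ u v : RatFunc k, z = algebraMap _ K u + algebraMap _ K v * y)
    (hA : A.comap (algebraMap (RatFunc k) K) = (ofIrreducible f hf).ring) {g : k[X]}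
    (hg : A.valuation (y - polyMap k K g) < 1) {z : K} (hz : z ∈ A) :
    ∃ p : k[X], A.valuation (z - polyMap k K p) < 1 := by
  obtain ⟨u, hu⟩ := exists_ratFunc_sub_lt_one hy hspan f hf g z
  have h1 := hu A hA hg
  have huA : algebraMap _ K u ∈ A := by
    have := sub_mem hz (ValuationSubring.mem_of_valuation_lt_one h1)
    simpa using this
  rw [← ValuationSubring.mem_comap, hA] at huA
  obtain ⟨p, hp⟩ := exists_polynomial_sub_lt_one hf huA
  rw [← ValuationSubring.valuation_lt_one_iff_of_comap hA, map_sub, ← polyMap_apply] at hp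
  refine ⟨p, ?_⟩
  have := Valuation.map_add_lt _ h1 hp
  simpa using this

/-- The approximating rational function of `z` is common to both places, so both decide membership
of `z` in the same way. -/
theorem valuationSubring_eq_of_sub_polyMap_lt_one [CharP K 2] {y : K} {c : RatFunc k}
    (hy : y ^ 2 + y = algebraMap (RatFunc k) K c)
    (hspan : ∀ z : K, ∃ u v : RatFunc k, z = algebraMap _ K u + algebraMap _ K v * y)
    {B : ValuationSubring K}
    (hA : A.comap (algebraMap (RatFunc k) K) = (ofIrreducible f hf).ring)
    (hB : B.comap (algebraMap (RatFunc k) K) = (ofIrreducible f hf).ring) {g : k[X]}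
    (hAg : A.valuation (y - polyMap k K g) < 1) (hBg : B.valuation (y - polyMap k K g) < 1) :
    A = B := by
  refine SetLike.ext fun z => ?_
  obtain ⟨u, hu⟩ := exists_ratFunc_sub_lt_one hy hspan f hf g z
  have key : ∀ C : ValuationSubring K,
      C.comap (algebraMap (RatFunc k) K) = (ofIrreducible f hf).ring →
      C.valuation (y - polyMap k K g) < 1 → (z ∈ C ↔ u ∈ (ofIrreducible f hf).ring) := by
    intro C hC hCg
    have h1 := ValuationSubring.mem_of_valuation_lt_one (hu C hC hCg)
    rw [← hC, ValuationSubring.mem_comap]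
    refine ⟨fun hz => ?_, fun hz => ?_⟩
    · simpa using sub_mem hz h1
    · simpa using add_mem h1 hz
  rw [key A hA hAg, key B hB hBg]

/-- By `hres` reduction maps `k[X]` onto the residue field, and its kernel is `(f)`. -/
theorem degree_eq_natDegree [Algebra k K] [IsScalarTower k (RatFunc k) K] (P : Place k K)
    (hP : P.LiesAbove (ofIrreducible f hf))
    (hres : ∀ z ∈ P.ring, ∃ p : k[X], P.ring.valuation (z - polyMap k K p) < 1) :
    P.degree = f.natDegree := by
  unfold degree
  let : Algebra k (IsLocalRing.ResidueField P.ring) :=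
    ((IsLocalRing.residue P.ring).comp P.constMap).toAlgebra
  let φ : k[X] →+* P.ring := (polyMap k K).codRestrict P.ring.toSubring (polyMap_mem hP)
  let ψ : k[X] →ₐ[k] IsLocalRing.ResidueField P.ring :=
    { (IsLocalRing.residue P.ring).comp φ with
      commutes' := fun c => by
        refine congrArg (IsLocalRing.residue P.ring) (Subtype.ext ?_)
        change polyMap k K (C c) = algebraMap k K c
        rw [polyMap_apply, RatFunc.algebraMap_C, ← RatFunc.algebraMap_eq_C,
          ← IsScalarTower.algebraMap_apply] }
  have hψ : ∀ p, ψ p = IsLocalRing.residue P.ring (φ p) := fun _ => rfl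
  have hsurj : Function.Surjective ψ := by
    intro z
    obtain ⟨⟨z, hz⟩, rfl⟩ := IsLocalRing.residue_surjective z
    obtain ⟨p, hp⟩ := hres z hz
    refine ⟨p, ?_⟩
    rw [hψ, eq_comm, ← sub_eq_zero, ← map_sub, IsLocalRing.residue_eq_zero_iff,
      ValuationSubring.valuation_lt_one_iff]
    exact hp
  have hker : RingHom.ker ψ = Ideal.span {f} := by
    ext p
    rw [RingHom.mem_ker, hψ, IsLocalRing.residue_eq_zero_iff,
      ValuationSubring.valuation_lt_one_iff, Ideal.mem_span_singleton]
    exact valuation_polyMap_lt_one_iff hP p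
  rw [← (Ideal.quotientKerAlgEquivOfSurjective hsurj).toLinearEquiv.finrank_eq,
    (Ideal.quotientEquivAlgOfEq k hker).toLinearEquiv.finrank_eq, finrank_quotient_span_eq_natDegree]

end OverRational

end Place

/-! ### Galois theory of Artin-Schreier and biquadratic extensions. -/

section ArtinSchreier

variable {F L : Type*} [Field F] [Field L] [Algebra F L]

theorem artinSchreier_eq_or_eq {L : Type*} [Field L] [CharP L 2] {a b : L}
    (h : a ^ 2 + a = b ^ 2 + b) : a = b ∨ a = b + 1 := by
  have h2 : (2 : L) = 0 := CharTwo.two_eq_zero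
  have : (a - b) * (a - (b + 1)) = 0 := by linear_combination h + (b ^ 2 - a * b + b - a) * h2
  rcases mul_eq_zero.1 this with h | h
  · exact Or.inl (sub_eq_zero.1 h)
  · exact Or.inr (sub_eq_zero.1 h)

variable {y : L} {c : F}

theorem artinSchreier_isIntegral (hy : y ^ 2 + y = algebraMap F L c) : IsIntegral F y := by
  refine ⟨X ^ 2 + X - C c, by monicity!, ?_⟩
  simp [hy]

theorem exists_eq_add_mul_of_mem_adjoin (hy : y ^ 2 + y = algebraMap F L c) {z : L}
    (hz : z ∈ F⟮y⟯) : ∃ u v : F, z = algebraMap F L u + algebraMap F L v * y := by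
  rw [← mem_toSubalgebra,
    adjoin_simple_toSubalgebra_of_isAlgebraic (artinSchreier_isIntegral hy).isAlgebraic] at hz
  induction hz using Algebra.adjoin_induction with
  | mem x hx =>
    rw [Set.mem_singleton_iff] at hx
    exact ⟨0, 1, by simp [hx]⟩
  | algebraMap r => exact ⟨r, 0, by simp⟩
  | add x y _ _ hx hy =>
    obtain ⟨u, v, rfl⟩ := hx
    obtain ⟨u', v', rfl⟩ := hy
    exact ⟨u + u', v + v', by simp only [map_add]; ring⟩
  | mul x x' _ _ hx hx' =>
    obtain ⟨u, v, rfl⟩ := hx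
    obtain ⟨u', v', rfl⟩ := hx'
    refine ⟨u * u' + v * v' * c, u * v' + v * u' - v * v', ?_⟩
    simp only [map_add, map_sub, map_mul, ← hy]
    ring

variable [CharP F 2]

theorem artinSchreier_isSeparable (hy : y ^ 2 + y = algebraMap F L c) : IsSeparable F y := by
  have hs : (X ^ 2 + X - C c : F[X]).Separable := by
    refine ⟨0, 1, ?_⟩
    simp only [derivative_sub, derivative_add, derivative_X_pow, derivative_X, derivative_C]
    have h2 : (C (2 : F) : F[X]) = 0 := by rw [CharTwo.two_eq_zero, C_0]
    simp only [Nat.cast_ofNat, h2]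
    ring
  exact hs.of_dvd (minpoly.dvd _ _ (by simp [hy]))

theorem artinSchreier_splits (hy : y ^ 2 + y = algebraMap F L c) :
    ((minpoly F y).map (algebraMap F L)).Splits := by
  have : CharP L 2 := charP_of_injective_algebraMap (algebraMap F L).injective 2
  have h2 : (2 : L[X]) = 0 := CharTwo.two_eq_zero
  have hf : ((X ^ 2 + X - C c : F[X]).map (algebraMap F L)) = (X - C y) * (X - C (y + 1)) := by
    simp only [Polynomial.map_sub, Polynomial.map_add, Polynomial.map_pow, map_X, map_C, ← hy]
    simp only [map_add, map_pow, map_one]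
    linear_combination (X - C y ^ 2 - C y + X * C y) * h2
  refine Splits.of_dvd (g := (X - C y) * (X - C (y + 1))) ?_ ?_ ?_
  · exact (Splits.X_sub_C _).mul (Splits.X_sub_C _)
  · exact mul_ne_zero (X_sub_C_ne_zero _) (X_sub_C_ne_zero _)
  · rw [← hf]
    exact Polynomial.map_dvd _ (minpoly.dvd _ _ (by simp [hy]))

theorem artinSchreier_apply_eq (hy : y ^ 2 + y = algebraMap F L c) (σ : L ≃ₐ[F] L) :
    σ y = y ∨ σ y = y + 1 := by
  have : CharP L 2 := charP_of_injective_algebraMap (algebraMap F L).injective 2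
  refine artinSchreier_eq_or_eq ?_
  rw [← map_pow, ← map_add, hy, AlgEquiv.commutes]

end ArtinSchreier

section Biquadratic

variable {F L : Type*} [Field F] [Field L] [Algebra F L] {y₁ y₂ : L} {c₁ c₂ : F}

/-- The fixed field of `τ⁻¹ * σ` contains both generators. -/
theorem biquadratic_algEquiv_ext (htop : F⟮y₁⟯ ⊔ F⟮y₂⟯ = ⊤) {σ τ : L ≃ₐ[F] L}
    (h₁ : σ y₁ = τ y₁) (h₂ : σ y₂ = τ y₂) : σ = τ := by
  let E : IntermediateField F L := fixedField (Subgroup.zpowers (τ⁻¹ * σ))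
  have hmem : ∀ z, σ z = τ z → z ∈ E := by
    intro z hz
    rw [mem_fixedField_iff]
    have h1 : τ⁻¹ * σ ∈ MulAction.stabilizer (L ≃ₐ[F] L) z := by
      rw [MulAction.mem_stabilizer_iff, mul_smul, inv_smul_eq_iff]
      exact hz
    exact fun g hg => (Subgroup.zpowers_le.2 h1) hg
  have hE : E = ⊤ := by
    rw [← top_le_iff, ← htop, sup_le_iff, adjoin_simple_le_iff, adjoin_simple_le_iff]
    exact ⟨hmem _ h₁, hmem _ h₂⟩
  ext z
  have hz : z ∈ E := hE ▸ IntermediateField.mem_top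
  rw [mem_fixedField_iff] at hz
  have := congrArg τ (hz _ (Subgroup.mem_zpowers _))
  simpa [AlgEquiv.mul_apply] using this

theorem mem_diagonalSubgroup_iff {σ : L ≃ₐ[F] L} :
    σ ∈ diagonalSubgroup F y₁ y₂ ↔ σ y₁ - y₁ = σ y₂ - y₂ := Iff.rfl

variable [CharP F 2]

theorem biquadratic_isGalois (hy₁ : y₁ ^ 2 + y₁ = algebraMap F L c₁)
    (hy₂ : y₂ ^ 2 + y₂ = algebraMap F L c₂) (htop : F⟮y₁⟯ ⊔ F⟮y₂⟯ = ⊤) :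
    IsGalois F L ∧ FiniteDimensional F L := by
  have hadj : IntermediateField.adjoin F {y₁, y₂} = ⊤ := by
    rw [Set.insert_eq, adjoin_union, htop]
  have hint : ∀ x ∈ ({y₁, y₂} : Set L), IsIntegral F x := by
    rintro x (rfl | rfl)
    exacts [artinSchreier_isIntegral hy₁, artinSchreier_isIntegral hy₂]
  have hfd : FiniteDimensional F L := by
    have := finiteDimensional_adjoin hint
    rw [hadj] at this
    exact topEquiv.toLinearEquiv.finiteDimensional
  have hsep : Algebra.IsSeparable F L := by
    have : Algebra.IsSeparable F (IntermediateField.adjoin F {y₁, y₂}) := by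
      rw [isSeparable_adjoin_iff_isSeparable]
      rintro x (rfl | rfl)
      exacts [artinSchreier_isSeparable hy₁, artinSchreier_isSeparable hy₂]
    rw [hadj] at this
    exact Algebra.IsSeparable.of_algHom F _ topEquiv.symm.toAlgHom
  have hnorm : Normal F L := by
    refine normal_iff.2 fun x => ⟨Algebra.IsIntegral.isIntegral x, ?_⟩
    refine splits_of_mem_adjoin F L (S := {y₁, y₂}) ?_ (by rw [hadj]; trivial)
    rintro x (rfl | rfl)
    exacts [⟨artinSchreier_isIntegral hy₁, artinSchreier_splits hy₁⟩,
      ⟨artinSchreier_isIntegral hy₂, artinSchreier_splits hy₂⟩]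
  exact ⟨⟨⟩, hfd⟩

/-- The Galois group of a biquadratic Artin-Schreier extension contains all three translations. -/
theorem biquadratic_exists_translations [FiniteDimensional F L] [IsGalois F L]
    (hy₁ : y₁ ^ 2 + y₁ = algebraMap F L c₁) (hy₂ : y₂ ^ 2 + y₂ = algebraMap F L c₂)
    (h₁ : ∀ z : F, z ^ 2 + z ≠ c₁) (h₂ : ∀ z : F, z ^ 2 + z ≠ c₂)
    (h₃ : ∀ z : F, z ^ 2 + z ≠ c₁ + c₂) :
    (∃ σ : L ≃ₐ[F] L, σ y₁ = y₁ + 1 ∧ σ y₂ = y₂ + 1) ∧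
    (∃ σ : L ≃ₐ[F] L, σ y₁ = y₁ + 1 ∧ σ y₂ = y₂) ∧
    (∃ σ : L ≃ₐ[F] L, σ y₁ = y₁ ∧ σ y₂ = y₂ + 1) := by
  have : CharP L 2 := charP_of_injective_algebraMap (algebraMap F L).injective 2
  have h2 : (2 : L) = 0 := CharTwo.two_eq_zero
  have h11 : ∀ a : L, a + 1 + 1 = a := fun a => by linear_combination h2
  have hmove : ∀ (y : L) (c : F), y ^ 2 + y = algebraMap F L c → (∀ z : F, z ^ 2 + z ≠ c) →
      ∃ σ : L ≃ₐ[F] L, σ y ≠ y := by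
    intro y c hy hc
    by_contra! hfix
    rw [← IsGalois.mem_bot_iff_fixed, IntermediateField.mem_bot] at hfix
    obtain ⟨z, rfl⟩ := hfix
    rw [← map_pow, ← map_add] at hy
    exact hc z ((algebraMap F L).injective hy)
  have hc := fun σ => artinSchreier_apply_eq hy₁ (σ := σ)
  have hd := fun σ => artinSchreier_apply_eq hy₂ (σ := σ)
  have hne : ∀ a : L, a + 1 ≠ a := fun a h => one_ne_zero (by linear_combination h : (1 : L) = 0)
  obtain ⟨σ, hσ⟩ := hmove _ _ hy₁ h₁
  obtain ⟨τ, hτ⟩ := hmove _ _ hy₂ h₂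
  -- An automorphism moving `y₁ + y₂` moves exactly one of `y₁`, `y₂`. Composing it with one that
  -- moves the other generator yields the missing translations.
  obtain ⟨ρ, hρ⟩ := hmove (y₁ + y₂) (c₁ + c₂)
    (by rw [map_add, ← hy₁, ← hy₂]; linear_combination y₁ * y₂ * h2) h₃
  have hσ := (hc σ).resolve_left hσ
  have hτ := (hd τ).resolve_left hτ
  rw [map_add] at hρ
  have comp : ∀ (α β : L ≃ₐ[F] L) z, (α * β) z = α (β z) := fun _ _ _ => rfl
  rcases hc ρ with e1 | e1 <;> rcases hd ρ with e2 | e2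
  · exact absurd (by rw [e1, e2]) hρ
  · rcases hd σ with e3 | e3
    · exact ⟨⟨σ * ρ, by rw [comp, e1, hσ], by rw [comp, e2, map_add, e3, map_one]⟩,
        ⟨σ, hσ, e3⟩, ⟨ρ, e1, e2⟩⟩
    · exact ⟨⟨σ, hσ, e3⟩,
        ⟨σ * ρ, by rw [comp, e1, hσ], by rw [comp, e2, map_add, e3, map_one, h11]⟩, ⟨ρ, e1, e2⟩⟩
  · rcases hc τ with e3 | e3
    · exact ⟨⟨τ * ρ, by rw [comp, e1, map_add, e3, map_one], by rw [comp, e2, hτ]⟩,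
        ⟨ρ, e1, e2⟩, ⟨τ, e3, hτ⟩⟩
    · exact ⟨⟨τ, e3, hτ⟩, ⟨ρ, e1, e2⟩,
        ⟨τ * ρ, by rw [comp, e1, map_add, e3, map_one, h11], by rw [comp, e2, hτ]⟩⟩
  · exact absurd (by rw [e1, e2]; linear_combination h2) hρ

theorem biquadratic_finrank [FiniteDimensional F L] [IsGalois F L] (htop : F⟮y₁⟯ ⊔ F⟮y₂⟯ = ⊤)
    (hy₁ : y₁ ^ 2 + y₁ = algebraMap F L c₁) (hy₂ : y₂ ^ 2 + y₂ = algebraMap F L c₂)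
    (h₁ : ∀ z : F, z ^ 2 + z ≠ c₁) (h₂ : ∀ z : F, z ^ 2 + z ≠ c₂)
    (h₃ : ∀ z : F, z ^ 2 + z ≠ c₁ + c₂) : Module.finrank F L = 4 := by
  obtain ⟨⟨τ, a1, a2⟩, ⟨ρ, b1, b2⟩, ⟨σ, d1, d2⟩⟩ :=
    biquadratic_exists_translations hy₁ hy₂ h₁ h₂ h₃
  -- An automorphism is determined by which of `y₁`, `y₂` it fixes, and all four possibilities
  -- occur.
  have hbij : Function.Bijective
      (fun g : L ≃ₐ[F] L => ((g y₁ = y₁, g y₂ = y₂) : Prop × Prop)) := by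
    constructor
    · intro α β h
      rw [Prod.mk.injEq, eq_iff_iff, eq_iff_iff] at h
      refine biquadratic_algEquiv_ext htop ?_ ?_
      · rcases artinSchreier_apply_eq hy₁ α with e | e <;>
        rcases artinSchreier_apply_eq hy₁ β with e' | e' <;> simp_all
      · rcases artinSchreier_apply_eq hy₂ α with e | e <;>
        rcases artinSchreier_apply_eq hy₂ β with e' | e' <;> simp_all
    · rintro ⟨p, q⟩
      by_cases hp : p <;> by_cases hq : q
      · exact ⟨1, by simp [hp, hq]⟩
      · exact ⟨σ, by simp [hp, hq, d1, d2]⟩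
      · exact ⟨ρ, by simp [hp, hq, b1, b2]⟩
      · exact ⟨τ, by simp [hp, hq, a1, a2]⟩
  rw [← IsGalois.card_aut_eq_finrank, Nat.card_congr (Equiv.ofBijective _ hbij)]
  simp

theorem mem_diagonalSubgroup_iff_apply_add {σ : L ≃ₐ[F] L} :
    σ ∈ diagonalSubgroup F y₁ y₂ ↔ σ (y₁ + y₂) = y₁ + y₂ := by
  have : CharP L 2 := charP_of_injective_algebraMap (algebraMap F L).injective 2
  have h2 : (2 : L) = 0 := CharTwo.two_eq_zero
  rw [mem_diagonalSubgroup_iff, map_add]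
  constructor <;> intro h
  · linear_combination h + (σ y₂ - y₂) * h2
  · linear_combination h - (σ y₂ - y₂) * h2

theorem eq_one_or_eq_of_mem_diagonalSubgroup (htop : F⟮y₁⟯ ⊔ F⟮y₂⟯ = ⊤)
    (hy₁ : y₁ ^ 2 + y₁ = algebraMap F L c₁) {σ τ : L ≃ₐ[F] L}
    (h₁ : τ y₁ = y₁ + 1) (h₂ : τ y₂ = y₂ + 1) (hσ : σ ∈ diagonalSubgroup F y₁ y₂) :
    σ = 1 ∨ σ = τ := by
  rw [mem_diagonalSubgroup_iff] at hσ
  rcases artinSchreier_apply_eq hy₁ σ with e | e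
  · exact Or.inl (biquadratic_algEquiv_ext htop (by simpa using e)
      (by rw [AlgEquiv.one_apply]; linear_combination -hσ + e))
  · exact Or.inr (biquadratic_algEquiv_ext htop (by rw [e, h₁])
      (by rw [h₂]; linear_combination -hσ + e))

/-- In characteristic two the diagonal condition says that `y₁ + y₂` is fixed, so the Galois
correspondence applies. -/
theorem fixedField_diagonalSubgroup [FiniteDimensional F L] [IsGalois F L] :
    fixedField (diagonalSubgroup F y₁ y₂) = F⟮y₁ + y₂⟯ := by
  have : diagonalSubgroup F y₁ y₂ = fixingSubgroup F⟮y₁ + y₂⟯ := by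
    ext σ
    rw [mem_diagonalSubgroup_iff_apply_add, IntermediateField.mem_fixingSubgroup_iff]
    refine ⟨fun h z hz => ?_, fun h => h _ (mem_adjoin_simple_self F _)⟩
    have hle : F⟮y₁ + y₂⟯ ≤ fixedField (Subgroup.zpowers σ) := by
      rw [adjoin_simple_le_iff, mem_fixedField_iff]
      have h1 : σ ∈ MulAction.stabilizer (L ≃ₐ[F] L) (y₁ + y₂) := h
      exact fun g hg => (Subgroup.zpowers_le.2 h1) hg
    exact (mem_fixedField_iff _ _).1 (hle hz) σ (Subgroup.mem_zpowers σ)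
  rw [this, IsGalois.fixedField_fixingSubgroup]

theorem finrank_fixedField_diagonalSubgroup [FiniteDimensional F L] (htop : F⟮y₁⟯ ⊔ F⟮y₂⟯ = ⊤)
    (hy₁ : y₁ ^ 2 + y₁ = algebraMap F L c₁) {τ : L ≃ₐ[F] L}
    (h₁ : τ y₁ = y₁ + 1) (h₂ : τ y₂ = y₂ + 1) :
    Module.finrank (fixedField (diagonalSubgroup F y₁ y₂)) L = 2 := by
  have hτ : τ ∈ diagonalSubgroup F y₁ y₂ := by
    rw [mem_diagonalSubgroup_iff, h₁, h₂]; ring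
  have hset : (diagonalSubgroup F y₁ y₂ : Set (L ≃ₐ[F] L)) = {1, τ} := by
    ext σ
    refine ⟨fun h => eq_one_or_eq_of_mem_diagonalSubgroup htop hy₁ h₁ h₂ h, ?_⟩
    rintro (rfl | rfl)
    exacts [one_mem _, hτ]
  have hne : (1 : L ≃ₐ[F] L) ≠ τ := by
    rintro rfl
    simp at h₁
  rw [finrank_fixedField_eq_card, ← SetLike.coe_sort_coe, hset, Nat.card_coe_set_eq,
    Set.ncard_pair hne]

theorem exists_fixedField_add_mul (htop : F⟮y₁⟯ ⊔ F⟮y₂⟯ = ⊤)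
    (hy₁ : y₁ ^ 2 + y₁ = algebraMap F L c₁) {τ : L ≃ₐ[F] L}
    (h₁ : τ y₁ = y₁ + 1) (h₂ : τ y₂ = y₂ + 1) (z : L) :
    ∃ u v : fixedField (diagonalSubgroup F y₁ y₂), z = algebraMap _ L u + algebraMap _ L v * y₁ := by
  have : CharP L 2 := charP_of_injective_algebraMap (algebraMap F L).injective 2
  have h2 : (2 : L) = 0 := CharTwo.two_eq_zero
  have hττ : ∀ z, τ (τ z) = z := by
    have : τ * τ = 1 := biquadratic_algEquiv_ext htop
      (by rw [AlgEquiv.mul_apply, h₁, map_add, h₁, map_one, AlgEquiv.one_apply]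
          linear_combination h2)
      (by rw [AlgEquiv.mul_apply, h₂, map_add, h₂, map_one, AlgEquiv.one_apply]
          linear_combination h2)
    exact fun z => congrArg (fun σ : L ≃ₐ[F] L => σ z) this
  have hmem : ∀ z, τ z = z → z ∈ fixedField (diagonalSubgroup F y₁ y₂) := by
    intro z hz
    rw [mem_fixedField_iff]
    intro σ hσ
    rcases eq_one_or_eq_of_mem_diagonalSubgroup htop hy₁ h₁ h₂ hσ with rfl | rfl
    exacts [rfl, hz]
  -- Applying `τ` to `u + v * y₁` adds `v`, which forces `v = τ z - z`.
  refine ⟨⟨z - (τ z - z) * y₁, hmem _ ?_⟩, ⟨τ z - z, hmem _ ?_⟩, ?_⟩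
  · rw [map_sub, map_mul, map_sub, hττ, h₁]
    linear_combination (τ z - z) * (1 + y₁) * h2
  · rw [map_sub, hττ]
    linear_combination (z - τ z) * h2
  · change z = z - (τ z - z) * y₁ + (τ z - z) * y₁
    ring

end Biquadratic

/-! ### The three Artin-Schreier equations have no rational solution. -/

section RationalFunctions

variable {k : Type*} [Field k]

/-- A solution has no finite pole, so it is a polynomial, and then `z (z + 1)` has even degree. -/
theorem not_artinSchreier_X (z : RatFunc k) : z ^ 2 + z ≠ RatFunc.X := by
  intro h
  have hd : algebraMap k[X] (RatFunc k) z.denom ≠ 0 := by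
    simpa using z.denom_ne_zero
  have e : z.num ^ 2 + z.num * z.denom = X * z.denom ^ 2 := by
    apply RatFunc.algebraMap_injective k
    rw [← z.num_div_denom] at h
    simp only [map_add, map_mul, map_pow, RatFunc.algebraMap_X]
    rw [← h]
    field_simp
  have hco := z.isCoprime_num_denom
  have hu : IsUnit z.denom := by
    have h1 : z.denom ∣ z.num ^ 2 := ⟨X * z.denom - z.num, by linear_combination e⟩
    exact (hco.symm.pow_right (n := 2)).isUnit_of_dvd' dvd_rfl h1
  rw [z.monic_denom.eq_one_of_isUnit hu, mul_one, one_pow, mul_one] at e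
  have hdeg := congrArg natDegree (show z.num * (z.num + C 1) = X by rw [C_1]; linear_combination e)
  have hn0 : z.num ≠ 0 := by
    intro h0
    rw [h0] at e
    exact X_ne_zero (by rw [← e]; ring)
  have hn1 : z.num + C 1 ≠ 0 := by
    intro h0
    rw [C_1] at h0
    have : (X : k[X]) = 0 := by linear_combination z.num * h0 - e
    exact X_ne_zero this
  rw [natDegree_mul hn0 hn1, natDegree_add_C, natDegree_X] at hdeg
  omega

/-- At `0` a pole of `z ^ 2 + z` has even order, while the right side has a simple pole. The
numerator `c` is general in order to cover both `1/x` and `x + 1/x`. -/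
theorem not_artinSchreier_div_X {c : k[X]} (hc : ¬ X ∣ c) (z : RatFunc k) :
    z ^ 2 + z ≠ algebraMap k[X] (RatFunc k) c / RatFunc.X := by
  intro h
  have hd : algebraMap k[X] (RatFunc k) z.denom ≠ 0 := by
    simpa using z.denom_ne_zero
  have hX : (RatFunc.X : RatFunc k) ≠ 0 := RatFunc.X_ne_zero
  have e : X * (z.num ^ 2 + z.num * z.denom) = c * z.denom ^ 2 := by
    apply RatFunc.algebraMap_injective k
    rw [← z.num_div_denom] at h
    simp only [map_add, map_mul, map_pow, RatFunc.algebraMap_X]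
    field_simp at h
    linear_combination h
  have h1 : X ∣ z.denom :=
    prime_X.dvd_of_dvd_pow ((prime_X.dvd_or_dvd (Dvd.intro _ e)).resolve_left hc)
  have h2 : X ∣ z.num := by
    obtain ⟨d, hd⟩ := h1
    have : z.num ^ 2 = X * (c * d ^ 2 - z.num * d) := by
      apply mul_left_cancel₀ (X_ne_zero : (X : k[X]) ≠ 0)
      rw [hd] at e
      linear_combination e
    exact prime_X.dvd_of_dvd_pow (Dvd.intro _ this.symm)
  exact prime_X.not_isUnit (z.isCoprime_num_denom.isUnit_of_dvd' h2 h1)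

end RationalFunctions

/-! ### Automorphisms stabilizing a valuation ring and their action on residues. -/

namespace ValuationSubring

variable {F L : Type*} [Field F] [Field L] [Algebra F L] {A : ValuationSubring L}

open scoped Pointwise in
theorem mem_decompositionSubgroup_iff {τ : L ≃ₐ[F] L} :
    τ ∈ A.decompositionSubgroup F ↔ A.comap (τ : L →+* L) = A := by
  rw [← inv_mem_iff, MulAction.mem_stabilizer_iff, SetLike.ext_iff, SetLike.ext_iff]
  refine forall_congr' fun z => ?_
  rw [mem_pointwise_smul_iff_inv_smul_mem, inv_inv, mem_comap]
  rfl

/-- The stabilizing map acts on residues, fixing that of `g`. If `y` were congruent to `g` or `g +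
1`, the residue of `y` (or of `y + g`) would be fixed too, yet it is shifted by `1`. -/
theorem not_lt_one_of_translation [CharP L 2] {τ : L →+* L} (hτ : A.comap τ = A) {y g : L}
    (hy : τ y = y + 1) (hg : τ g = g) : ¬ A.valuation (y ^ 2 + y + (g ^ 2 + g)) < 1 := by
  intro h
  have h2 : (2 : L) = 0 := CharTwo.two_eq_zero
  have key : ∀ w, A.valuation w < 1 → τ w = w + 1 → False := by
    intro w hw hw1
    have h1 := (valuation_lt_one_iff_of_comap hτ w).2 hw
    have h3 := Valuation.map_sub_lt _ h1 hw
    rw [hw1, add_sub_cancel_left, map_one] at h3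
    exact lt_irrefl _ h3
  have e : y ^ 2 + y + (g ^ 2 + g) = (y + g) * (y + g + 1) := by
    linear_combination -y * g * h2
  rw [e] at h
  rcases valuation_lt_one_of_mul h with h | h
  · exact key _ h (by rw [map_add, hy, hg]; ring)
  · exact key _ h (by rw [map_add, map_add, hy, hg, map_one]; ring)

end ValuationSubring

/-! ### `A`-polynomials and the places above them. -/

namespace Place

section

variable {k L : Type*} [Field k] [Field L] [Algebra (RatFunc k) L] {f : k[X]}
  {hf : Irreducible f} {A : ValuationSubring L}

theorem valuation_inv_X_sub_lt_one [CharP L 2]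
    (hA : A.comap (algebraMap (RatFunc k) L) = (ofIrreducible f hf).ring) {h : k[X]}
    (hh : f ∣ h * X + 1) :
    A.valuation (algebraMap (RatFunc k) L (1 / RatFunc.X) + polyMap k L h) < 1 := by
  have hX : polyMap k L X ≠ 0 := by simp [polyMap_apply, RatFunc.X_ne_zero]
  have e : algebraMap (RatFunc k) L (1 / RatFunc.X) + polyMap k L h =
      polyMap k L (h * X + 1) * (polyMap k L X)⁻¹ := by
    rw [one_div, map_inv₀, ← RatFunc.algebraMap_X, ← polyMap_apply, map_add, map_mul, map_one]
    field_simp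
    ring
  rw [e]
  refine ValuationSubring.valuation_mul_lt_one ((valuation_polyMap_lt_one_iff hA _).2 hh)
    (ValuationSubring.inv_mem_of_not_lt_one ?_)
  rw [valuation_polyMap_lt_one_iff hA]
  intro hX
  -- If `f` divided `X`, then `f ∣ h * X + 1` would make it divide `1`; so `X` is a unit at the
  -- place.
  exact hf.not_isUnit (isUnit_of_dvd_one ((Nat.cast_one (R := k[X])) ▸
    (dvd_add_right (hX.mul_left h)).1 (by simpa using hh)))

theorem not_artinSchreierSolvable_of_translation [CharP L 2]
    (hA : A.comap (algebraMap (RatFunc k) L) = (ofIrreducible f hf).ring)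
    {τ : L ≃ₐ[RatFunc k] L} (hτ : A.comap (τ : L →+* L) = A) {y : L} (hy : τ y = y + 1)
    {c : k[X]} (hc : A.valuation (y ^ 2 + y + polyMap k L c) < 1) :
    ¬ ArtinSchreierSolvable f c := by
  rintro ⟨g, hg⟩
  have h2 : (2 : L) = 0 := CharTwo.two_eq_zero
  refine ValuationSubring.not_lt_one_of_translation hτ (g := polyMap k L g) hy
    (τ.commutes _) ?_
  have h1 := Valuation.map_add_lt _ hc ((valuation_polyMap_lt_one_iff hA _).2 hg)
  convert h1 using 2
  simp only [map_add, map_pow]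
  linear_combination -polyMap k L c * h2

/-- A polynomial is an `A`-polynomial if the diagonal translation stabilizes a place above it. -/
theorem isAPolynomial_of_translation [Finite k] [Algebra (ZMod 2) k] [CharP L 2] (hfm : f.Monic)
    (hA : A.comap (algebraMap (RatFunc k) L) = (ofIrreducible f hf).ring) {y₁ y₂ : L}
    (hy₁ : y₁ ^ 2 + y₁ = algebraMap (RatFunc k) L RatFunc.X)
    (hy₂ : y₂ ^ 2 + y₂ = algebraMap (RatFunc k) L (1 / RatFunc.X))
    {τ : L ≃ₐ[RatFunc k] L} (hτ : A.comap (τ : L →+* L) = A)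
    (h₁ : τ y₁ = y₁ + 1) (h₂ : τ y₂ = y₂ + 1) : IsAPolynomial f := by
  have hS1 : ¬ ArtinSchreierSolvable f X := by
    refine not_artinSchreierSolvable_of_translation hA hτ h₁ ?_
    rw [hy₁, polyMap_apply, RatFunc.algebraMap_X, CharTwo.add_self_eq_zero, map_zero]
    exact zero_lt_one
  have h0 : f.coeff 0 ≠ 0 := by
    intro h0
    -- For `f` associated to `X`, the equation `g ^ 2 + g = x` modulo `f` has the solution `0`.
    refine hS1 ⟨0, ?_⟩
    have : Associated X f := (irreducible_X.dvd_irreducible_iff_associated hf).1 (X_dvd_iff.2 h0)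
    simpa using this.symm.dvd
  obtain ⟨h, hh⟩ := exists_dvd_mul_X_add_one h0
  refine (isAPolynomial_iff hfm hf h0 hh).2 ⟨hS1, ?_⟩
  refine not_artinSchreierSolvable_of_translation hA hτ h₂ ?_
  rw [hy₂]
  exact valuation_inv_X_sub_lt_one hA hh

theorem valuation_diagonal_lt_one [CharP L 2]
    (hA : A.comap (algebraMap (RatFunc k) L) = (ofIrreducible f hf).ring) {y : L}
    (hy : y ^ 2 + y = algebraMap (RatFunc k) L (RatFunc.X + 1 / RatFunc.X)) {h : k[X]}
    (hh : f ∣ h * X + 1) : A.valuation (y ^ 2 + y + polyMap k L (X + h)) < 1 := by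
  have h2 : (2 : L) = 0 := CharTwo.two_eq_zero
  convert valuation_inv_X_sub_lt_one hA hh using 2
  rw [hy, map_add, map_add, polyMap_apply X, RatFunc.algebraMap_X]
  linear_combination algebraMap (RatFunc k) L RatFunc.X * h2

theorem sub_polyMap_lt_one_or [CharP L 2]
    (hA : A.comap (algebraMap (RatFunc k) L) = (ofIrreducible f hf).ring) {y : L}
    (hy : y ^ 2 + y = algebraMap (RatFunc k) L (RatFunc.X + 1 / RatFunc.X)) {g h : k[X]}
    (hh : f ∣ h * X + 1) (hg : f ∣ g ^ 2 + g + (X + h)) :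
    A.valuation (y - polyMap k L g) < 1 ∨ A.valuation (y - polyMap k L (g + 1)) < 1 := by
  have h2 : (2 : L) = 0 := CharTwo.two_eq_zero
  have h1 := Valuation.map_add_lt _ (valuation_diagonal_lt_one hA hy hh)
    ((valuation_polyMap_lt_one_iff hA _).2 hg)
  have e : y ^ 2 + y + polyMap k L (X + h) + polyMap k L (g ^ 2 + g + (X + h)) =
      (y - polyMap k L g) * (y - polyMap k L (g + 1)) := by
    rw [map_add _ (g ^ 2 + g), map_add _ (g ^ 2), map_pow, map_add _ g, map_one]
    linear_combination (polyMap k L (X + h) + y + y * polyMap k L g) * h2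
  rw [e] at h1
  exact ValuationSubring.valuation_lt_one_of_mul h1

theorem _root_.IsAPolynomial.exists_sub_polyMap_lt_one [Finite k] [Algebra (ZMod 2) k] [CharP L 2]
    (hfA : IsAPolynomial f)
    (hA : A.comap (algebraMap (RatFunc k) L) = (ofIrreducible f hf).ring) {y : L}
    (hy : y ^ 2 + y = algebraMap (RatFunc k) L (RatFunc.X + 1 / RatFunc.X)) {h : k[X]}
    (hh : f ∣ h * X + 1) :
    ∃ g : k[X], f ∣ g ^ 2 + g + (X + h) ∧ A.valuation (y - polyMap k L g) < 1 := by
  have : CharP k 2 := charP_of_injective_algebraMap (algebraMap (ZMod 2) k).injective 2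
  have h2 : (2 : k[X]) = 0 := CharTwo.two_eq_zero
  obtain ⟨g, hg⟩ := hfA.artinSchreierSolvable_add hh
  rcases sub_polyMap_lt_one_or hA hy hh hg with h1 | h1
  · exact ⟨g, hg, h1⟩
  · refine ⟨g + 1, ?_, h1⟩
    convert hg using 1
    linear_combination (g + 1) * h2

end

section

variable {k L : Type*} [Field k] [Field L] [Algebra k L]

/-- The place `{z | σ z ∈ P}`. -/
def comap {F : Type*} [Field F] [Algebra F L] [Algebra k F] [IsScalarTower k F L] (P : Place k L)
    (σ : L ≃ₐ[F] L) : Place k L where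
  ring := P.ring.comap (σ : L →+* L)
  algebraMap_mem c := by
    rw [ValuationSubring.mem_comap, IsScalarTower.algebraMap_apply k F L]
    exact (σ.commutes _).symm ▸ IsScalarTower.algebraMap_apply k F L c ▸ P.algebraMap_mem c
  ne_top h := P.ne_top (_root_.eq_top_iff.2 fun z _ => by
    have : σ.symm z ∈ P.ring.comap (σ : L →+* L) := h ▸ ValuationSubring.mem_top _
    rw [ValuationSubring.mem_comap] at this
    simpa using this)

theorem LiesAbove.comap {F K : Type*} [Field F] [Algebra F L] [Algebra k F] [IsScalarTower k F L]
    [Field K] [Algebra k K] [Algebra K L] {P' : Place k L} {P : Place k K} (h : P'.LiesAbove P)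
    {σ : L ≃ₐ[F] L} (hσ : ∀ z : K, σ (algebraMap K L z) = algebraMap K L z) :
    (P'.comap σ).LiesAbove P := by
  refine Eq.trans (SetLike.ext fun z => ?_) h
  rw [ValuationSubring.mem_comap, ValuationSubring.mem_comap]
  change σ (algebraMap K L z) ∈ P'.ring ↔ _
  rw [hσ]

theorem LiesAbove.trans {F K : Type*} [Field F] [Algebra F L] [Algebra k F]
    [Field K] [Algebra k K] [Algebra K L] [Algebra F K] [IsScalarTower F K L]
    {P'' : Place k L} {P' : Place k K} {P : Place k F} (h : P''.LiesAbove P')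
    (h' : P'.LiesAbove P) : P''.LiesAbove P := by
  unfold LiesAbove at *
  rw [IsScalarTower.algebraMap_eq F K L, ← ValuationSubring.comap_comap, h, h']

theorem LiesAbove.restrict {F K : Type*} [Field F] [Algebra F L] [Algebra k F]
    [Field K] [Algebra k K] [Algebra K L] [Algebra F K] [IsScalarTower F K L] [IsScalarTower k K L]
    [Algebra.IsAlgebraic K L] {P' : Place k L} {P : Place k F} (h : P'.LiesAbove P) :
    (P'.restrict K).LiesAbove P := by
  unfold LiesAbove at *
  rw [← h, IsScalarTower.algebraMap_eq F K L, ← ValuationSubring.comap_comap]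
  rfl

end

section Tower

variable {k E L : Type*} [Field k] [Finite k] [Algebra (ZMod 2) k] [Field E] [Field L]
  [Algebra k E] [Algebra k L] [Algebra (RatFunc k) E] [Algebra (RatFunc k) L] [Algebra E L]
  [IsScalarTower k E L]
  [IsScalarTower (RatFunc k) E L] [CharP E 2]
  {y₁ : L} {y : E} {f : k[X]} {hf : Irreducible f}

/-- The residue of `y` is polynomial, so the residue field does not grow from `P_f` to `P`. Hence
the equation of `y₁`, unsolvable modulo `f`, remains unsolvable at `P`. -/
theorem degree_and_isInert_of_isAPolynomial [IsScalarTower k (RatFunc k) E]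
    (hy₁ : y₁ ^ 2 + y₁ = algebraMap (RatFunc k) L RatFunc.X)
    (hy : y ^ 2 + y = algebraMap (RatFunc k) E (RatFunc.X + 1 / RatFunc.X))
    (hspan : ∀ z : E, ∃ u v : RatFunc k, z = algebraMap _ E u + algebraMap _ E v * y)
    (hspan' : ∀ z : L, ∃ u v : E, z = algebraMap _ L u + algebraMap _ L v * y₁)
    (hrank : Module.finrank E L = 2)
    (hfA : IsAPolynomial f) {P : Place k E} (hP : P.LiesAbove (ofIrreducible f hf)) :
    P.degree = f.natDegree ∧ P.IsInert L := by
  have h2 : (2 : E) = 0 := CharTwo.two_eq_zero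
  obtain ⟨h, hh⟩ := exists_dvd_mul_X_add_one hfA.2.2.2.1
  obtain ⟨g, -, hg⟩ := hfA.exists_sub_polyMap_lt_one hP hy hh
  have hres : ∀ z ∈ P.ring, ∃ p : k[X], P.ring.valuation (z - polyMap k E p) < 1 :=
    fun z hz => exists_polyMap_sub_lt_one hy hspan hP hg hz
  refine ⟨degree_eq_natDegree P hP hres, ?_⟩
  refine isInert_of_irreducible P (y := y₁) (c := polyMap k E X) hspan' hrank (polyMap_mem hP X) ?_
    fun z hz hlt => ?_
  · rw [hy₁, polyMap_apply, RatFunc.algebraMap_X, ← IsScalarTower.algebraMap_apply]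
  obtain ⟨p, hp⟩ := hres z hz
  refine ((isAPolynomial_iff hfA.1 hf hfA.2.2.2.1 hh).1 hfA).1 ⟨p, ?_⟩
  rw [← valuation_polyMap_lt_one_iff hP]
  have hm : z + polyMap k E p + 1 ∈ P.ring :=
    add_mem (add_mem hz (polyMap_mem hP p)) P.ring.one_mem
  -- Subtracting `(z - p) (z + p + 1)` replaces the root `z` by its polynomial representative `p`.
  have := Valuation.map_sub_lt _ hlt (ValuationSubring.valuation_mul_lt_one hp hm)
  convert this using 2
  rw [map_add, map_add, map_pow]
  ring

/-- There are exactly two places of `E` above an `A`-polynomial. -/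
theorem exists_liesAbove_eq_pair [IsScalarTower k (RatFunc k) L] [Algebra.IsAlgebraic E L]
    (hy : y ^ 2 + y = algebraMap (RatFunc k) E (RatFunc.X + 1 / RatFunc.X))
    (hspan : ∀ z : E, ∃ u v : RatFunc k, z = algebraMap _ E u + algebraMap _ E v * y)
    {ρ : L ≃ₐ[RatFunc k] L} (hρ : ρ (algebraMap E L y) = algebraMap E L y + 1)
    (hf : Irreducible f) (hfA : IsAPolynomial f) :
    ∃ P Q : Place k E, P ≠ Q ∧ {R : Place k E | R.LiesAbove (ofIrreducible f hf)} = {P, Q} := by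
  have h2 : (2 : E) = 0 := CharTwo.two_eq_zero
  obtain ⟨P', hP'⟩ := (ofIrreducible f hf).exists_liesAbove (L := L)
  have hQ' : (P'.comap ρ).LiesAbove (ofIrreducible f hf) := hP'.comap ρ.commutes
  have hP := hP'.restrict (K := E)
  have hQ := hQ'.restrict (K := E)
  obtain ⟨h, hh⟩ := exists_dvd_mul_X_add_one hfA.2.2.2.1
  obtain ⟨g, hgf, hg⟩ := hfA.exists_sub_polyMap_lt_one hP hy hh
  -- Since `ρ` sends `y` to `y + 1`, the second place gives `y` the other residue `g + 1`. The two
  -- residues separate the places, and no third residue is possible.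
  have hg' : ((P'.comap ρ).restrict E).ring.valuation (y - polyMap k E (g + 1)) < 1 := by
    have hc1 : P'.ring.comap (ρ : L →+* L) = (P'.comap ρ).ring := rfl
    have hc2 : (P'.comap ρ).ring.comap (algebraMap E L) = ((P'.comap ρ).restrict E).ring := rfl
    have hc3 : P'.ring.comap (algebraMap E L) = (P'.restrict E).ring := rfl
    rw [← ValuationSubring.valuation_lt_one_iff_of_comap hc2,
      ← ValuationSubring.valuation_lt_one_iff_of_comap hc1]
    rw [← ValuationSubring.valuation_lt_one_iff_of_comap hc3] at hg
    convert hg using 2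
    change ρ _ = _
    rw [map_sub, map_sub, hρ, map_sub, map_add, map_one, map_add, map_add, map_one, map_one,
      polyMap_apply, ← IsScalarTower.algebraMap_apply, AlgEquiv.commutes]
    ring
  refine ⟨P'.restrict E, (P'.comap ρ).restrict E, fun h => ?_, Set.ext fun R => ?_⟩
  · rw [← h] at hg'
    have := Valuation.map_sub_lt _ hg hg'
    simp at this
  · refine ⟨fun hR => ?_, ?_⟩
    · rcases sub_polyMap_lt_one_or hR hy hh hgf with h | h
      · exact Or.inl (Place.ext (valuationSubring_eq_of_sub_polyMap_lt_one hy hspan hR hP h hg))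
      · exact Or.inr (Place.ext (valuationSubring_eq_of_sub_polyMap_lt_one hy hspan hR hQ h hg'))
    · rintro (rfl | rfl)
      exacts [hP, hQ]

end Tower

end Place

theorem finite_setOf_isAPolynomial (k : Type*) [Field k] [Finite k] [Algebra (ZMod 2) k] (n : ℕ) :
    {f : k[X] | IsAPolynomial f ∧ f.natDegree = n}.Finite := by
  have hfin : Finite (degreeLT k (n + 1)) := .of_equiv _ (degreeLTEquiv k (n + 1)).symm.toEquiv
  refine (Set.toFinite (degreeLT k (n + 1) : Set k[X])).subset ?_
  rintro f ⟨-, hf⟩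
  refine mem_degreeLT.2 (degree_le_natDegree.trans_lt ?_)
  rw [hf]
  exact_mod_cast n.lt_succ_self

/-! ### Decomposition groups and the count of inert places. -/

namespace Place

section Tower

variable {k E L : Type*} [Field k] [Finite k] [Algebra (ZMod 2) k] [Field E] [Field L]
  [Algebra k E] [Algebra k L] [Algebra (RatFunc k) E] [Algebra (RatFunc k) L] [Algebra E L]
  [IsScalarTower k (RatFunc k) E] [IsScalarTower k (RatFunc k) L]
  [IsScalarTower (RatFunc k) E L] [CharP L 2]
  {y₁ y₂ : L} {y : E}

/-- A place of `E` that is inert in `L` lies above an `A`-polynomial. -/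
theorem IsInert.exists_isAPolynomial [Algebra.IsAlgebraic (RatFunc k) E]
    {P : Place k E} (hP : P.IsInert L)
    (hy₁ : y₁ ^ 2 + y₁ = algebraMap (RatFunc k) L RatFunc.X)
    (hy₂ : y₂ ^ 2 + y₂ = algebraMap (RatFunc k) L (1 / RatFunc.X))
    {τ : L ≃ₐ[RatFunc k] L} (hτ : ∀ z : E, τ (algebraMap E L z) = algebraMap E L z)
    (h₁ : τ y₁ = y₁ + 1) (h₂ : τ y₂ = y₂ + 1) :
    ∃ (f : k[X]) (hf : Irreducible f), IsAPolynomial f ∧ P.LiesAbove (ofIrreducible f hf) := by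
  obtain ⟨P', hP', huniq, -⟩ := hP
  -- Only the uniqueness half of inertness is needed: `τ` fixes `E`, so it carries `P'` to a place
  -- above the same `P`.
  have hstab : P'.ring.comap (τ : L →+* L) = P'.ring :=
    congrArg Place.ring (huniq (P'.comap τ) (hP'.comap hτ))
  have hPF : P'.LiesAbove (P.restrict (RatFunc k)) := hP'.trans (P.liesAbove_restrict)
  by_cases hX : RatFunc.X ∈ (P.restrict (RatFunc k)).ring
  · obtain ⟨f, hfm, hf, hPf⟩ := eq_ofIrreducible_of_X_mem _ hX
    rw [hPf] at hPF
    exact ⟨f, hf, isAPolynomial_of_translation hfm hPF hy₁ hy₂ hstab h₁ h₂,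
      hPf ▸ P.liesAbove_restrict⟩
  -- At the infinite place `1/x` is small, so `y₂` has residue `0` or `1`, which a stabilizing shift
  -- of `y₂` forbids.
  · refine absurd ?_ (ValuationSubring.not_lt_one_of_translation hstab (g := 0) h₂ (map_zero _))
    rw [hy₂, zero_pow two_ne_zero, add_zero, add_zero,
      ValuationSubring.valuation_lt_one_iff_of_comap hPF, one_div,
      ← ValuationSubring.mem_nonunits_iff, ValuationSubring.inv_mem_nonunits_iff]
    exact Or.inr hX

variable [IsScalarTower k E L] [CharP E 2]

/-- The `A`-polynomials are those whose decomposition group is the diagonal subgroup. -/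
theorem isAPolynomial_iff_decompositionSubgroup_eq
    (hy₁ : y₁ ^ 2 + y₁ = algebraMap (RatFunc k) L RatFunc.X)
    (hy₂ : y₂ ^ 2 + y₂ = algebraMap (RatFunc k) L (1 / RatFunc.X))
    (hyy : algebraMap E L y = y₁ + y₂)
    (hspan : ∀ z : E, ∃ u v : RatFunc k, z = algebraMap _ E u + algebraMap _ E v * y)
    (hspan' : ∀ z : L, ∃ u v : E, z = algebraMap _ L u + algebraMap _ L v * y₁)
    (hrank : Module.finrank E L = 2)
    (hH : ∀ σ ∈ diagonalSubgroup (RatFunc k) y₁ y₂, ∀ z : E,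
      σ (algebraMap E L z) = algebraMap E L z)
    {τ : L ≃ₐ[RatFunc k] L} (h₁ : τ y₁ = y₁ + 1) (h₂ : τ y₂ = y₂ + 1)
    {f : k[X]} (hfm : f.Monic) (hf : Irreducible f) {P' : Place k L}
    (hP' : P'.LiesAbove (ofIrreducible f hf)) :
    IsAPolynomial f ↔
      P'.ring.decompositionSubgroup (RatFunc k) = diagonalSubgroup (RatFunc k) y₁ y₂ := by
  have h2 : (2 : L) = 0 := CharTwo.two_eq_zero
  have : FiniteDimensional E L := Module.finite_of_finrank_pos (by omega)
  have : CharP k 2 := charP_of_injective_algebraMap (algebraMap (ZMod 2) k).injective 2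
  have : CharP (RatFunc k) 2 :=
    charP_of_injective_algebraMap (algebraMap k (RatFunc k)).injective 2
  have hy12 : (y₁ + y₂) ^ 2 + (y₁ + y₂) =
      algebraMap (RatFunc k) L (RatFunc.X + 1 / RatFunc.X) := by
    rw [map_add, ← hy₁, ← hy₂]
    linear_combination y₁ * y₂ * h2
  have hy : y ^ 2 + y = algebraMap (RatFunc k) E (RatFunc.X + 1 / RatFunc.X) := by
    apply (algebraMap E L).injective
    rw [map_add, map_pow, hyy, hy12, ← IsScalarTower.algebraMap_apply]
  constructor
  · intro hfA
    ext σ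
    rw [ValuationSubring.mem_decompositionSubgroup_iff]
    refine ⟨fun hσ => ?_, fun hσ => ?_⟩
    · rw [mem_diagonalSubgroup_iff_apply_add]
      -- If `σ` shifted `y₁ + y₂`, the equation for `x + 1/x` would be unsolvable modulo `f`,
      -- contrary to the cancellation of the two traces.
      refine (artinSchreier_apply_eq hy12 σ).resolve_right fun h => ?_
      obtain ⟨g, hg⟩ := exists_dvd_mul_X_add_one hfA.2.2.2.1
      exact not_artinSchreierSolvable_of_translation hP' hσ h
        (valuation_diagonal_lt_one hP' hy12 hg) (hfA.artinSchreierSolvable_add hg)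
    · have hP : (P'.restrict E).LiesAbove (ofIrreducible f hf) := hP'.restrict
      obtain ⟨Q, -, huniq, -⟩ :=
        (degree_and_isInert_of_isAPolynomial hy₁ hy hspan hspan' hrank hfA hP).2
      have hPE : P'.LiesAbove (P'.restrict E) := P'.liesAbove_restrict
      exact congrArg Place.ring
        ((huniq (P'.comap σ) (hPE.comap (hH σ hσ))).trans (huniq P' hPE).symm)
  · intro hD
    have hτ : τ ∈ P'.ring.decompositionSubgroup (RatFunc k) := by
      rw [hD, mem_diagonalSubgroup_iff, h₁, h₂]
      ring
    exact isAPolynomial_of_translation hfm hP' hy₁ hy₂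
      (ValuationSubring.mem_decompositionSubgroup_iff.1 hτ) h₁ h₂

variable [Algebra.IsAlgebraic (RatFunc k) E]

theorem setOf_isInert_eq (hy₁ : y₁ ^ 2 + y₁ = algebraMap (RatFunc k) L RatFunc.X)
    (hy₂ : y₂ ^ 2 + y₂ = algebraMap (RatFunc k) L (1 / RatFunc.X))
    (hy : y ^ 2 + y = algebraMap (RatFunc k) E (RatFunc.X + 1 / RatFunc.X))
    (hspan : ∀ z : E, ∃ u v : RatFunc k, z = algebraMap _ E u + algebraMap _ E v * y)
    (hspan' : ∀ z : L, ∃ u v : E, z = algebraMap _ L u + algebraMap _ L v * y₁)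
    (hrank : Module.finrank E L = 2)
    {τ : L ≃ₐ[RatFunc k] L} (hτ : ∀ z : E, τ (algebraMap E L z) = algebraMap E L z)
    (h₁ : τ y₁ = y₁ + 1) (h₂ : τ y₂ = y₂ + 1) (n : ℕ) :
    {P : Place k E | P.degree = n ∧ P.IsInert L} =
      ⋃ f ∈ {f : k[X] | IsAPolynomial f ∧ f.natDegree = n},
        {P : Place k E | ∃ hf : Irreducible f, P.LiesAbove (ofIrreducible f hf)} := by
  ext P
  simp only [Set.mem_ofPred_eq, Set.mem_iUnion, exists_prop]
  constructor
  · rintro ⟨hn, hP⟩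
    obtain ⟨f, hf, hfA, hPf⟩ := hP.exists_isAPolynomial hy₁ hy₂ hτ h₁ h₂
    have hdeg := (degree_and_isInert_of_isAPolynomial hy₁ hy hspan hspan' hrank hfA hPf).1
    exact ⟨f, ⟨hfA, hdeg.symm.trans hn⟩, hf, hPf⟩
  · rintro ⟨f, ⟨hfA, rfl⟩, hf, hPf⟩
    exact degree_and_isInert_of_isAPolynomial hy₁ hy hspan hspan' hrank hfA hPf

theorem finite_and_numInertPlaces_eq (hy₁ : y₁ ^ 2 + y₁ = algebraMap (RatFunc k) L RatFunc.X)
    (hy₂ : y₂ ^ 2 + y₂ = algebraMap (RatFunc k) L (1 / RatFunc.X))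
    (hy : y ^ 2 + y = algebraMap (RatFunc k) E (RatFunc.X + 1 / RatFunc.X))
    (hspan : ∀ z : E, ∃ u v : RatFunc k, z = algebraMap _ E u + algebraMap _ E v * y)
    (hspan' : ∀ z : L, ∃ u v : E, z = algebraMap _ L u + algebraMap _ L v * y₁)
    (hrank : Module.finrank E L = 2)
    {τ : L ≃ₐ[RatFunc k] L} (hτ : ∀ z : E, τ (algebraMap E L z) = algebraMap E L z)
    (h₁ : τ y₁ = y₁ + 1) (h₂ : τ y₂ = y₂ + 1)
    {ρ : L ≃ₐ[RatFunc k] L} (hρ : ρ (algebraMap E L y) = algebraMap E L y + 1) (n : ℕ) :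
    {P : Place k E | P.degree = n ∧ P.IsInert L}.Finite ∧
      numInertPlaces k E L n = 2 * numAPolynomials k n := by
  have : FiniteDimensional E L := Module.finite_of_finrank_pos (by omega)
  have hT := finite_setOf_isAPolynomial k n
  have hpair : ∀ f ∈ {f : k[X] | IsAPolynomial f ∧ f.natDegree = n}, ∃ P Q : Place k E, P ≠ Q ∧
      {P : Place k E | ∃ hf : Irreducible f, P.LiesAbove (ofIrreducible f hf)} = {P, Q} := by
    rintro f ⟨hfA, -⟩
    obtain ⟨P, Q, hne, h⟩ := exists_liesAbove_eq_pair hy hspan hρ hfA.2.1 hfA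
    refine ⟨P, Q, hne, h ▸ Set.ext fun R => ?_⟩
    exact ⟨fun ⟨_, h⟩ => h, fun h => ⟨hfA.2.1, h⟩⟩
  have hfin : ∀ f ∈ {f : k[X] | IsAPolynomial f ∧ f.natDegree = n},
      {P : Place k E | ∃ hf : Irreducible f, P.LiesAbove (ofIrreducible f hf)}.Finite := by
    intro f hf
    obtain ⟨P, Q, -, h⟩ := hpair f hf
    rw [h]
    exact Set.toFinite _
  -- A place of `E` determines its restriction to `k(x)`, hence the monic polynomial `f`; the count
  -- is therefore two for each `A`-polynomial.
  have hdisj : {f : k[X] | IsAPolynomial f ∧ f.natDegree = n}.PairwiseDisjoint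
      fun f => {P : Place k E | ∃ hf : Irreducible f, P.LiesAbove (ofIrreducible f hf)} := by
    rintro f ⟨hf, -⟩ g ⟨hg, -⟩ hne
    refine Set.disjoint_left.2 ?_
    rintro P ⟨hf', hPf⟩ ⟨hg', hPg⟩
    exact hne (ofIrreducible_injective hf' hg' hf.1 hg.1 (Place.ext (hPf.symm.trans hPg)))
  unfold numInertPlaces numAPolynomials
  rw [setOf_isInert_eq hy₁ hy₂ hy hspan hspan' hrank hτ h₁ h₂ n]
  refine ⟨hT.biUnion hfin, ?_⟩
  rw [hT.ncard_biUnion hfin hdisj]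
  have hcard : ∀ f ∈ {f : k[X] | IsAPolynomial f ∧ f.natDegree = n},
      {P : Place k E | ∃ hf : Irreducible f, P.LiesAbove (ofIrreducible f hf)}.ncard = 2 := by
    intro f hf
    obtain ⟨P, Q, hne, h⟩ := hpair f hf
    rw [h, Set.ncard_pair hne]
  rw [finsum_mem_congr rfl hcard, finsum_mem_eq_finite_toFinset_sum _ hT, Finset.sum_const,
    smul_eq_mul, mul_comm, Set.ncard_eq_toFinset_card _ hT]

end Tower

end Place

theorem proposition2 (r : ℕ) (k : Type*) [Field k] [Fintype k] [Algebra (ZMod 2) k]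
    (hk : Fintype.card k = 2 ^ r)
    (E' : Type*) [Field E'] [Algebra k E'] [Algebra (RatFunc k) E'] [IsScalarTower k (RatFunc k) E']
    (y₁ y₂ : E')
    (hy₁ : y₁ ^ 2 + y₁ = algebraMap (RatFunc k) E' RatFunc.X)
    (hy₂ : y₂ ^ 2 + y₂ = algebraMap (RatFunc k) E' (1 / RatFunc.X))
    (hE' : (RatFunc k)⟮y₁⟯ ⊔ (RatFunc k)⟮y₂⟯ = ⊤) :
    -- the setting: a biquadratic extension, and the fixed field of the diagonal subgroup
    (IsGalois (RatFunc k) E' ∧ Module.finrank (RatFunc k) E' = 4 ∧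
      fixedField (diagonalSubgroup (RatFunc k) y₁ y₂) = (RatFunc k)⟮y₁ + y₂⟯) ∧
    -- the decomposition groups
    (∀ (f : k[X]) (_ : f.Monic) (hf : Irreducible f) (P' : Place k E'),
      P'.LiesAbove (Place.ofIrreducible f hf) →
        (IsAPolynomial f ↔
          P'.ring.decompositionSubgroup (RatFunc k) = diagonalSubgroup (RatFunc k) y₁ y₂)) ∧
    -- the number of inert places
    (∀ n : ℕ, 1 ≤ n →
      {P : Place k (fixedField (diagonalSubgroup (RatFunc k) y₁ y₂)) |
        P.degree = n ∧ P.IsInert E'}.Finite ∧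
      numInertPlaces k (fixedField (diagonalSubgroup (RatFunc k) y₁ y₂)) E' n =
        2 * numAPolynomials k n) := by
  have hchk : CharP k 2 := charP_of_injective_algebraMap (algebraMap (ZMod 2) k).injective 2
  have : CharP (RatFunc k) 2 :=
    charP_of_injective_algebraMap (algebraMap k (RatFunc k)).injective 2
  have : CharP E' 2 := charP_of_injective_algebraMap (algebraMap (RatFunc k) E').injective 2
  have : CharP (fixedField (diagonalSubgroup (RatFunc k) y₁ y₂)) 2 :=
    charP_of_injective_algebraMap (algebraMap (RatFunc k) _).injective 2
  have : IsScalarTower k (fixedField (diagonalSubgroup (RatFunc k) y₁ y₂)) E' :=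
    .of_algebraMap_eq fun _ => rfl
  have h2 : (2 : E') = 0 := CharTwo.two_eq_zero
  obtain ⟨hgal, hfd⟩ := biquadratic_isGalois hy₁ hy₂ hE'
  have hn₁ : ∀ z : RatFunc k, z ^ 2 + z ≠ RatFunc.X := not_artinSchreier_X
  have hn₂ : ∀ z : RatFunc k, z ^ 2 + z ≠ 1 / RatFunc.X := fun z => by
    have h := not_artinSchreier_div_X (c := (1 : k[X])) prime_X.not_dvd_one z
    rwa [map_one] at h
  have hn₃ : ∀ z : RatFunc k, z ^ 2 + z ≠ RatFunc.X + 1 / RatFunc.X := fun z => by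
    -- Here `x + 1/x` is written as `(x ^ 2 + 1) / x`.
    have hc : ¬ (X : k[X]) ∣ X ^ 2 + 1 := fun h =>
      prime_X.not_dvd_one ((dvd_add_right (dvd_pow_self X two_ne_zero)).1 h)
    have h := not_artinSchreier_div_X hc z
    have hX : (RatFunc.X : RatFunc k) ≠ 0 := RatFunc.X_ne_zero
    convert h using 1
    rw [map_add, map_pow, map_one, RatFunc.algebraMap_X]
    field_simp
  obtain ⟨⟨τ, a1, a2⟩, ⟨ρ, b1, b2⟩, -⟩ := biquadratic_exists_translations hy₁ hy₂ hn₁ hn₂ hn₃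
  have hfix : fixedField (diagonalSubgroup (RatFunc k) y₁ y₂) = (RatFunc k)⟮y₁ + y₂⟯ :=
    fixedField_diagonalSubgroup
  have hτ : τ ∈ diagonalSubgroup (RatFunc k) y₁ y₂ := by
    rw [mem_diagonalSubgroup_iff, a1, a2]
    ring
  have hH : ∀ σ ∈ diagonalSubgroup (RatFunc k) y₁ y₂,
      ∀ z : fixedField (diagonalSubgroup (RatFunc k) y₁ y₂),
      σ (algebraMap _ E' z) = algebraMap _ E' z :=
    fun σ hσ z => (mem_fixedField_iff _ _).1 z.2 σ hσ
  have hmem : y₁ + y₂ ∈ fixedField (diagonalSubgroup (RatFunc k) y₁ y₂) :=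
    hfix ▸ mem_adjoin_simple_self _ _
  let y : fixedField (diagonalSubgroup (RatFunc k) y₁ y₂) := ⟨y₁ + y₂, hmem⟩
  have hy12 : (y₁ + y₂) ^ 2 + (y₁ + y₂) =
      algebraMap (RatFunc k) E' (RatFunc.X + 1 / RatFunc.X) := by
    rw [map_add, ← hy₁, ← hy₂]
    linear_combination y₁ * y₂ * h2
  have hy : y ^ 2 + y = algebraMap (RatFunc k) _ (RatFunc.X + 1 / RatFunc.X) := Subtype.ext hy12
  have hspan : ∀ z : fixedField (diagonalSubgroup (RatFunc k) y₁ y₂), ∃ u v : RatFunc k,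
      z = algebraMap _ _ u + algebraMap _ _ v * y := fun z => by
    obtain ⟨u, v, h⟩ := exists_eq_add_mul_of_mem_adjoin hy12 (hfix.le z.2)
    exact ⟨u, v, Subtype.ext h⟩
  have hspan' := exists_fixedField_add_mul hE' hy₁ a1 a2
  have hrank := finrank_fixedField_diagonalSubgroup hE' hy₁ a1 a2
  refine ⟨⟨hgal, biquadratic_finrank hE' hy₁ hy₂ hn₁ hn₂ hn₃, hfix⟩, fun f hfm hf P' hP' => ?_,
    fun n _ => ?_⟩
  · exact Place.isAPolynomial_iff_decompositionSubgroup_eq (y := y) hy₁ hy₂ rfl hspan hspan' hrank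
      hH a1 a2 hfm hf hP'
  -- The automorphism `ρ` moves `y₁` and fixes `y₂`, so it shifts `y` by `1` and exchanges the two
  -- places over each `A`-polynomial.
  · refine Place.finite_and_numInertPlaces_eq hy₁ hy₂ hy hspan hspan' hrank (hH τ hτ) a1 a2
      (ρ := ρ) ?_ n
    change ρ (y₁ + y₂) = y₁ + y₂ + 1
    rw [map_add, b1, b2]
    ring
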